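/- Let $(X,\Phi,Y,\Phi^\vee,\Pi)$ be a root datum with a base $\Pi$ of simple roots, Weyl group $W$ and length function $\ell$. Let $I$ be a finite set, $\mathcal A=\mathbb Z[q_i^{\pm1}\mid i\in I]$, and let $\mathbf q:\Phi\to\{q_i\mid i\in I\}$ be constant on $W$-orbits. The affine Hecke algebra $\mathcal H^{\mathrm{aff}}=\mathcal H^{\mathrm{aff}}_{\mathbf q}$ is the (unital, associative) $\mathcal A$-algebra generated by $T_w$ $(w\in W)$ and $e^\lambda$ $(\lambda\in X)$ with $T_1=e^0=1$ and the relations (i) $T_{s_\alpha}^2=(\mathbf q(\alpha)-1)T_{s_\alpha}+\mathbf q(\alpha)$ for $\alpha\in\Pi$; (ii) $T_wT_{w'}=T_{ww'}$ if $\ell(ww')=\ell(w)+\ell(w')$; (iii) $e^\lambda e^\mu=e^{\lambda+\mu}$; (iv) $e^\lambda T_{s_\alpha}-T_{s_\alpha}e^{s_\alpha(\lambda)}=(\mathbf q(\alpha)-1)\dfrac{e^\lambda-e^{s_\alpha(\lambda)}}{1-e^{-\alpha}}$ for $\alpha\in\Pi$, $\lambda\in X$. It has the $\mathcal A$-basis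 $\{T_we^\lambda\}$ and centre $\mathcal A[X]^W$. For a point $a=(s,(t_i)_{i\in I})$ of the complex torus $\hat{\mathcal T}=\mathrm{Hom}(X,\mathbb C^\times)\times(\mathbb C^\times)^I$, let $\chi_a:\mathcal A[X]^W\to\mathbb C$ be evaluation at $a$ (that is, $e^\lambda\mapsto s(\lambda)$, $q_i\mapsto t_i$), and let $\mathcal H^{\mathrm{aff}}_{\chi_a}=(\mathbb C\otimes_{\mathbb Z}\mathcal H^{\mathrm{aff}})/(z-\chi_a(z)\mid z\in\mathcal A[X]^W)$. Call $a$ positive real if $s(\lambda)\in\mathbb R_{>0}$ for all $\lambda\in X$ and $t_i\in\mathbb R_{>0}$ for all $i\in I$. For a ring $R$ let $\mathrm{Irr}(R)$ be the set of isomorphism classes of simple left $R$-modules. Let $(X',\Phi',Y',\Phi'^\vee,\Pi')$ be a second root datum with base, and let $f:X'\to X$ be a central isogeny of based root data, as induced on character lattices by a central isogeny $G\to G'$ of connected reductive groups: $f$ is an injective homomorphism with finite cokernel, it restricts to a bijection $\Phi'\to\Phi$ which maps $\Pi'$ onto $\Pi$, and the transpose $Y\to Y'$ of $f$ sends the coroot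 of $f(\alpha')$ to the coroot of $\alpha'$ for each $\alpha'\in\Phi'$. Let $\mathcal H'^{\mathrm{aff}}$ be the affine Hecke algebra of the second datum with parameter function $\mathbf q\circ f|_{\Phi'}$, and for $a=(s,(t_i))\in\hat{\mathcal T}$ put $a'=(s\circ f,(t_i))$. If $a$ is positive real, then restriction along the canonical homomorphism $\mathcal H'^{\mathrm{aff}}_{\chi_{a'}}\to\mathcal H^{\mathrm{aff}}_{\chi_a}$, given by $e^{\lambda'}\mapsto e^{f(\lambda')}$ and $T_{w'}\mapsto T_w$ where $w'\mapsto w$ is the isomorphism of Weyl groups induced by $f$, sends simple modules to simple modules and induces a bijection $\mathrm{Irr}(\mathcal H^{\mathrm{aff}}_{\chi_a})\to\mathrm{Irr}(\mathcal H'^{\mathrm{aff}}_{\chi_{a'}})$. -/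

import Mathlib

open scoped TensorProduct

universe v

noncomputable section

namespace AffHecke

section RootData

variable {ι X Y : Type*} [AddCommGroup X] [AddCommGroup Y]
variable {ι' X' Y' : Type*} [AddCommGroup X'] [AddCommGroup Y']

/-- The length of `w ∈ W` with respect to the simple reflections `s_α`, `α ∈ Π`: the smallest
length of a word in the simple reflections whose product is `w`. -/
def weylLength {P : RootDatum ι X Y} (b : P.Base) (w : P.weylGroup) : ℕ :=
  sInf {n | ∃ l : List b.support,
    l.length = n ∧ (l.map fun i : b.support => RootPairing.weylGroup.ofIdx P i).prod = w}

/-- The morphism of based root data `(X', Φ', Π') → (X, Φ, Π)` induced (contravariantly on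
character lattices) by a central isogeny `G → G'` of reductive groups: an injective homomorphism
`X' → X` with finite cokernel which restricts to a bijection `Φ' → Φ`, whose transpose `Y → Y'`
maps the coroots to the corresponding coroots (these conditions are part of `RootPairing.Hom`),
and which matches the simple roots. -/
structure IsCentralIsogeny {P' : RootDatum ι' X' Y'} {P : RootDatum ι X Y}
    (b' : P'.Base) (b : P.Base) (f : RootPairing.Hom P' P) : Prop where
  injective : Function.Injective f.weightMap
  finite_coker : Finite (X ⧸ LinearMap.range f.weightMap)
  map_base : ∀ i : ι', f.indexEquiv i ∈ b.support ↔ i ∈ b'.support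

/-- A parameter function `Φ → {q_i | i ∈ I}` that is constant on `W`-orbits; the value `q_i` is
recorded by its index `i`. -/
structure ParameterFunction (P : RootDatum ι X Y) (I : Type*) where
  toFun : ι → I
  map_weyl : ∀ (w : P.weylGroup) (j : ι), toFun (P.weylGroupToPerm w j) = toFun j

/-- The ring of Laurent polynomials `𝒜 = ℤ[q_i^{±1} | i ∈ I]`. -/
abbrev LaurentRing (I : Type*) := AddMonoidAlgebra ℤ (I →₀ ℤ)

/-- The variable `q_i ∈ 𝒜`. -/
def qVar {I : Type*} (i : I) : LaurentRing I :=
  AddMonoidAlgebra.single (Finsupp.single i 1) 1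

/-- The group algebra `𝒜[X]` of the character lattice. -/
abbrev LatticeAlgebra (I X : Type*) [AddCommGroup X] := AddMonoidAlgebra (LaurentRing I) X

/-- The basis element `e^x ∈ 𝒜[X]`. -/
def latExp (I : Type*) (x : X) : LatticeAlgebra I X := AddMonoidAlgebra.single x 1

/-- The element `(e^x - e^{s_α(x)}) / (1 - e^{-α})` of `𝒜[X]`, written out as a finite sum. -/
def bernsteinQuotient (P : RootDatum ι X Y) (I : Type*) (i : ι) (x : X) : LatticeAlgebra I X :=
  ∑ k ∈ Finset.range (P.coroot' i x).toNat, latExp I (x - k • P.root i) -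
    ∑ k ∈ Finset.range (-P.coroot' i x).toNat, latExp I (P.reflection i x - k • P.root i)

lemma latExp_add (I : Type*) (x y : X) : latExp I (x + y) = latExp I x * latExp I y := by
  simp [latExp, AddMonoidAlgebra.single_mul_single]

lemma latExp_zero (I : Type*) : latExp I (0 : X) = 1 := rfl

lemma one_sub_mul_sum (I : Type*) (x y : X) (n : ℕ) :
    (1 - latExp I (-y)) * ∑ k ∈ Finset.range n, latExp I (x - k • y)
      = latExp I x - latExp I (x - n • y) := by
  have h : ∀ k : ℕ, (1 - latExp I (-y)) * latExp I (x - k • y)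
      = latExp I (x - k • y) - latExp I (x - (k + 1) • y) := by
    intro k
    rw [sub_mul, one_mul, ← latExp_add]
    congr 2
    rw [add_smul, one_smul]; abel
  rw [Finset.mul_sum, Finset.sum_congr rfl fun k _ => h k,
    Finset.sum_range_sub' (fun k : ℕ => latExp I (x - k • y))]
  simp

/-- `bernsteinQuotient` is the fraction it is meant to be (and the only element with this
property, as `𝒜[X]` is a domain). -/
theorem one_sub_mul_bernsteinQuotient (P : RootDatum ι X Y) (I : Type*) (i : ι) (x : X) :
    (1 - latExp I (-P.root i)) * bernsteinQuotient P I i x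
      = latExp I x - latExp I (P.reflection i x) := by
  rw [bernsteinQuotient, mul_sub, one_sub_mul_sum, one_sub_mul_sum]
  have hr := P.reflection_apply i x
  rw [hr]
  set n : ℤ := P.coroot' i x with hn
  rcases le_total 0 n with h | h
  · have h1 : ((n.toNat : ℕ) • P.root i : X) = n • P.root i := by
      rw [← natCast_zsmul, Int.toNat_of_nonneg h]
    have h2 : (-n).toNat = 0 := by omega
    rw [h1, h2]; simp
  · have h1 : (((-n).toNat : ℕ) • P.root i : X) = (-n) • P.root i := by
      rw [← natCast_zsmul, Int.toNat_of_nonneg (by omega)]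
    have h2 : n.toNat = 0 := by omega
    rw [h1, h2]; simp

end RootData

section Hecke

variable {ι X Y I : Type*} [AddCommGroup X] [AddCommGroup Y]

/-- The free `𝒜`-algebra on symbols `T_w` (`w ∈ W`) and `e^x` (`x ∈ X`). -/
abbrev FreeHecke (P : RootDatum ι X Y) (I : Type*) := FreeAlgebra (LaurentRing I) (P.weylGroup ⊕ X)

/-- The symbol `T_w`. -/
def freeT {P : RootDatum ι X Y} (I : Type*) (w : P.weylGroup) : FreeHecke P I :=
  FreeAlgebra.ι _ (Sum.inl w)

/-- The symbol `e^x`. -/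
def freeE (P : RootDatum ι X Y) (I : Type*) (x : X) : FreeHecke P I :=
  FreeAlgebra.ι _ (Sum.inr x)

/-- The `𝒜`-linear map `𝒜[X] → FreeHecke` with `e^x ↦ e^x`. -/
def freeLin (P : RootDatum ι X Y) (I : Type*) (z : LatticeAlgebra I X) : FreeHecke P I :=
  z.coeff.sum fun x c => c • freeE P I x

/-- The defining relations of the affine Hecke algebra. -/
inductive HeckeRel {P : RootDatum ι X Y} (b : P.Base) (q : ParameterFunction P I) :
    FreeHecke P I → FreeHecke P I → Prop
  | T_one : HeckeRel b q (freeT I 1) 1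
  | E_zero : HeckeRel b q (freeE P I 0) 1
  | quadratic (i : ι) (hi : i ∈ b.support) :
      HeckeRel b q
        (freeT I (RootPairing.weylGroup.ofIdx P i) * freeT I (RootPairing.weylGroup.ofIdx P i))
        ((qVar (q.toFun i) - 1) • freeT I (RootPairing.weylGroup.ofIdx P i) +
          algebraMap (LaurentRing I) _ (qVar (q.toFun i)))
  | T_mul (w w' : P.weylGroup) (h : weylLength b (w * w') = weylLength b w + weylLength b w') :
      HeckeRel b q (freeT I w * freeT I w') (freeT I (w * w'))
  | E_add (x y : X) : HeckeRel b q (freeE P I x * freeE P I y) (freeE P I (x + y))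
  | bernstein (i : ι) (hi : i ∈ b.support) (x : X) :
      HeckeRel b q
        (freeE P I x * freeT I (RootPairing.weylGroup.ofIdx P i) -
          freeT I (RootPairing.weylGroup.ofIdx P i) * freeE P I (P.reflection i x))
        ((qVar (q.toFun i) - 1) • freeLin P I (bernsteinQuotient P I i x))

/-- The affine Hecke algebra `ℋ^aff_q` over `𝒜` of a based root datum with parameter function `q`
(in the Bernstein presentation). -/
def AffineHecke {P : RootDatum ι X Y} (b : P.Base) (q : ParameterFunction P I) :=
  RingQuot (HeckeRel b q)

variable {P : RootDatum ι X Y} (b : P.Base) (q : ParameterFunction P I)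

instance : Ring (AffineHecke b q) := inferInstanceAs (Ring (RingQuot (HeckeRel b q)))

instance : Algebra (LaurentRing I) (AffineHecke b q) :=
  inferInstanceAs (Algebra (LaurentRing I) (RingQuot (HeckeRel b q)))

/-- The quotient map from the free algebra. -/
def heckeMk : FreeHecke P I →ₐ[LaurentRing I] AffineHecke b q :=
  RingQuot.mkAlgHom (LaurentRing I) (HeckeRel b q)

/-- The element `T_w` of the affine Hecke algebra. -/
def heckeT (w : P.weylGroup) : AffineHecke b q := heckeMk b q (freeT I w)

/-- The element `e^x` of the affine Hecke algebra. -/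
def heckeE (x : X) : AffineHecke b q := heckeMk b q (freeE P I x)

variable {b q} in
lemma heckeMk_rel {x y : FreeHecke P I} (h : HeckeRel b q x y) :
    heckeMk b q x = heckeMk b q y :=
  RingQuot.mkAlgHom_rel _ h

/-- The canonical algebra homomorphism `𝒜[X] → ℋ^aff_q`, `e^x ↦ e^x`. -/
def latToHecke : LatticeAlgebra I X →ₐ[LaurentRing I] AffineHecke b q :=
  AddMonoidAlgebra.lift (LaurentRing I) (AffineHecke b q) X
    { toFun := fun x => heckeE b q x.toAdd
      map_one' := by
        simpa [heckeE] using heckeMk_rel (HeckeRel.E_zero (b := b) (q := q))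
      map_mul' := fun x y => by
        simpa [heckeE] using
          (heckeMk_rel (HeckeRel.E_add (b := b) (q := q) x.toAdd y.toAdd)).symm }

/-- `z ∈ 𝒜[X]^W`, the centre of the affine Hecke algebra. -/
def IsWeylInvariant (P : RootDatum ι X Y) (z : LatticeAlgebra I X) : Prop :=
  ∀ w : P.weylGroup, AddMonoidAlgebra.mapDomain (fun x : X => w • x) z = z

/-- A point `a = (s, (t_i)_{i ∈ I})` of the complex torus
`Spec ℂ[X × ℤ^I] = Hom(X, ℂˣ) × (ℂˣ)^I`. -/
structure TorusPoint (X I : Type*) [AddCommGroup X] where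
  s : Multiplicative X →* ℂˣ
  t : I → ℂˣ

/-- `a` is positive real: it lies in `Hom(X, ℝ_{>0}) × (ℝ_{>0})^I`. -/
def TorusPoint.IsPositiveReal (a : TorusPoint X I) : Prop :=
  (∀ x : X, ∃ r : ℝ, 0 < r ∧ ((a.s (Multiplicative.ofAdd x) : ℂˣ) : ℂ) = r) ∧
    ∀ i : I, ∃ r : ℝ, 0 < r ∧ ((a.t i : ℂˣ) : ℂ) = r

/-- The evaluation `𝒜 → ℂ`, `q_i ↦ t_i`. -/
def evalParam (t : I → ℂˣ) : LaurentRing I →+* ℂ :=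
  (AddMonoidAlgebra.lift ℤ ℂ (I →₀ ℤ)
    { toFun := fun n => ((n.toAdd.prod fun i k => t i ^ k : ℂˣ) : ℂ)
      map_one' := by simp
      map_mul' := fun m n => by
        rw [toAdd_mul, Finsupp.prod_add_index' (by simp) (fun i k l => zpow_add (t i) k l)]
        simp }).toRingHom

/-- Evaluation at `a`, a ring homomorphism `𝒜[X] → ℂ` with `e^x ↦ s(x)`, `q_i ↦ t_i`. Its
restriction to `𝒜[X]^W` is the central character `χ_a`. -/
def TorusPoint.eval (a : TorusPoint X I) : LatticeAlgebra I X →+* ℂ :=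
  AddMonoidAlgebra.liftNCRingHom (evalParam a.t) ((Units.coeHom ℂ).comp a.s)
    fun _ _ => Commute.all _ _

/-- The relations `z = χ_a(z)`, `z ∈ 𝒜[X]^W`, on `ℂ ⊗ ℋ^aff_q`. -/
def CentralRel (a : TorusPoint X I) (u v : ℂ ⊗[ℤ] AffineHecke b q) : Prop :=
  ∃ z : LatticeAlgebra I X, IsWeylInvariant P z ∧
    u = (1 : ℂ) ⊗ₜ[ℤ] latToHecke b q z ∧ v = algebraMap ℂ _ (a.eval z)

/-- The specialized affine Hecke algebra
`ℋ^aff_{χ_a} = (ℂ ⊗ ℋ^aff_q) / (ker χ_a) = ℋ^aff_q ⊗_{Z(ℋ^aff_q)} ℂ_a`. -/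
def SpecHecke (a : TorusPoint X I) := RingQuot (CentralRel b q a)

instance (a : TorusPoint X I) : Ring (SpecHecke b q a) :=
  inferInstanceAs (Ring (RingQuot (CentralRel b q a)))

instance (a : TorusPoint X I) : Algebra ℂ (SpecHecke b q a) :=
  inferInstanceAs (Algebra ℂ (RingQuot (CentralRel b q a)))

/-- The quotient map `ℂ ⊗ ℋ^aff_q → ℋ^aff_{χ_a}`. -/
def specMk (a : TorusPoint X I) : ℂ ⊗[ℤ] AffineHecke b q →ₐ[ℂ] SpecHecke b q a :=
  RingQuot.mkAlgHom ℂ (CentralRel b q a)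

end Hecke

section Irr

variable {R S : Type*} [Ring R] [Ring S]

/-- Isomorphism of simple modules. -/
def simpleSetoid (R : Type*) [Ring R] :
    Setoid {M : ModuleCat.{v} R // IsSimpleModule R M} where
  r M N := Nonempty (M.1 ≃ₗ[R] N.1)
  iseqv := ⟨fun _ => ⟨LinearEquiv.refl _ _⟩, fun ⟨e⟩ => ⟨e.symm⟩, fun ⟨e⟩ ⟨e'⟩ => ⟨e.trans e'⟩⟩

/-- `Irr R`: the isomorphism classes of simple (left) `R`-modules. -/
def Irr (R : Type*) [Ring R] := Quotient (simpleSetoid.{v} R)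

/-- Restriction of modules along `φ` sends simple modules to simple modules. -/
def RestrictsSimples (φ : R →+* S) : Prop :=
  ∀ M : ModuleCat.{v} S, IsSimpleModule S M →
    IsSimpleModule R ((ModuleCat.restrictScalars φ).obj M)

/-- The map `Irr S → Irr R` given by restriction along `φ : R → S`, if that preserves simples. -/
def Irr.restrict (φ : R →+* S) (h : RestrictsSimples.{v} φ) : Irr.{v} S → Irr.{v} R :=
  Quotient.map (sa := simpleSetoid.{v} S) (sb := simpleSetoid.{v} R)
    (fun M => ⟨(ModuleCat.restrictScalars φ).obj M.1, h M.1 M.2⟩)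
    fun _ _ ⟨e⟩ => ⟨((ModuleCat.restrictScalars φ).mapIso e.toModuleIso).toLinearEquiv⟩

end Irr

end AffHecke

namespace AffHecke

section Isogeny

variable {ι X Y I : Type*} [AddCommGroup X] [AddCommGroup Y]
variable {ι' X' Y' : Type*} [AddCommGroup X'] [AddCommGroup Y']
variable {P' : RootDatum ι' X' Y'} {P : RootDatum ι X Y} {b' : P'.Base} {b : P.Base}
variable {f : RootPairing.Hom P' P}

lemma weyl_smul_eq (P : RootDatum ι X Y) (w : P.weylGroup) (x : X) :
    w • x = (w : RootPairing.Aut P).toHom.weightMap x := rfl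

lemma weyl_ext {w v : P.weylGroup} (h : ∀ x : X, w • x = v • x) : w = v := by
  have h1 : (w : RootPairing.Aut P).toHom = (v : RootPairing.Aut P).toHom :=
    RootPairing.Hom.weightHom_injective P (LinearMap.ext fun x => h x)
  apply Subtype.ext
  exact RootPairing.Equiv.ext (by rw [h1]) (by rw [h1]) (by rw [h1])

lemma ofIdx_smul_eq (P : RootDatum ι X Y) (i : ι) (x : X) :
    RootPairing.weylGroup.ofIdx P i • x = P.reflection i x := rfl

lemma coroot'_weightMap (f : RootPairing.Hom P' P) (i : ι') (x : X') :
    P.coroot' (f.indexEquiv i) (f.weightMap x) = P'.coroot' i x := by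
  have h := LinearMap.congr_fun
    (f.weight_coweight_transpose_apply P' P (P.coroot (f.indexEquiv i))) x
  rw [f.coroot_coweightMap_apply, Equiv.symm_apply_apply] at h
  exact h

lemma weightMap_reflection (f : RootPairing.Hom P' P) (i : ι') (x : X') :
    f.weightMap (P'.reflection i x) = P.reflection (f.indexEquiv i) (f.weightMap x) := by
  rw [RootPairing.reflection_apply, RootPairing.reflection_apply, coroot'_weightMap, map_sub,
    map_smul, f.root_weightMap_apply]

lemma IsCentralIsogeny.weyl_ext (hf : IsCentralIsogeny b' b f) {w v : P.weylGroup}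
    (h : ∀ x : X', w • f.weightMap x = v • f.weightMap x) : w = v := by
  apply AffHecke.weyl_ext
  intro x
  have := hf.finite_coker
  have hn : Nat.card (X ⧸ LinearMap.range f.weightMap) • x ∈ LinearMap.range f.weightMap := by
    rw [← Submodule.Quotient.mk_eq_zero, Submodule.Quotient.mk_smul]
    exact card_nsmul_eq_zero'
  obtain ⟨y, hy⟩ := hn
  have h2 := h y
  rw [hy, weyl_smul_eq, weyl_smul_eq, map_nsmul, map_nsmul] at h2
  have : Module.IsReflexive ℤ X := .of_isPerfPair P.toLinearMap
  have : Module.IsTorsionFree ℤ X := inferInstance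
  have h3 : (Nat.card (X ⧸ LinearMap.range f.weightMap) : ℤ) • (w • x)
      = (Nat.card (X ⧸ LinearMap.range f.weightMap) : ℤ) • (v • x) := by
    simpa [weyl_smul_eq] using h2
  exact smul_right_injective X (by exact_mod_cast Nat.card_pos.ne') h3

lemma exists_weylMap (f : RootPairing.Hom P' P) (w' : P'.weylGroup) :
    ∃ w : P.weylGroup, ∀ x : X', f.weightMap (w' • x) = w • f.weightMap x := by
  obtain ⟨w', hw'⟩ := w'
  induction hw' using RootPairing.weylGroup.induction with
  | mem i => exact ⟨RootPairing.weylGroup.ofIdx P (f.indexEquiv i), weightMap_reflection f i⟩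
  | one => exact ⟨1, fun x => by rw [one_smul]; rfl⟩
  | mul x y hx hy h1 h2 =>
    obtain ⟨w1, h1⟩ := h1
    obtain ⟨w2, h2⟩ := h2
    refine ⟨w1 * w2, fun z => ?_⟩
    rw [mul_smul, ← h2, ← h1]; rfl

/-- The canonical isomorphism `W' → W` of Weyl groups, as a homomorphism; it is characterized by
`f (w' x) = w f(x)`. -/
def IsCentralIsogeny.weylMap (hf : IsCentralIsogeny b' b f) : P'.weylGroup →* P.weylGroup where
  toFun w' := (exists_weylMap f w').choose
  map_one' := hf.weyl_ext fun x => by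
    rw [← (exists_weylMap f 1).choose_spec, one_smul, one_smul]
  map_mul' w v := hf.weyl_ext fun x => by
    rw [← (exists_weylMap f (w * v)).choose_spec, mul_smul, mul_smul,
      ← (exists_weylMap f v).choose_spec, ← (exists_weylMap f w).choose_spec]

lemma IsCentralIsogeny.weightMap_smul (hf : IsCentralIsogeny b' b f) (w : P'.weylGroup) (x : X') :
    f.weightMap (w • x) = hf.weylMap w • f.weightMap x :=
  (exists_weylMap f w).choose_spec x

lemma IsCentralIsogeny.weylMap_ofIdx (hf : IsCentralIsogeny b' b f) (i : ι') :
    hf.weylMap (RootPairing.weylGroup.ofIdx P' i) =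
      RootPairing.weylGroup.ofIdx P (f.indexEquiv i) :=
  hf.weyl_ext fun x => by
    rw [← hf.weightMap_smul, ofIdx_smul_eq, ofIdx_smul_eq, weightMap_reflection]

lemma IsCentralIsogeny.weylMap_injective (hf : IsCentralIsogeny b' b f) :
    Function.Injective hf.weylMap := fun w v h =>
  AffHecke.weyl_ext fun x => hf.injective (by rw [hf.weightMap_smul, hf.weightMap_smul, h])

lemma IsCentralIsogeny.weylMap_surjective (hf : IsCentralIsogeny b' b f) :
    Function.Surjective hf.weylMap := by
  rintro ⟨w, hw⟩
  induction hw using RootPairing.weylGroup.induction with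
  | mem i =>
    refine ⟨RootPairing.weylGroup.ofIdx P' (f.indexEquiv.symm i), ?_⟩
    rw [hf.weylMap_ofIdx, Equiv.apply_symm_apply]; rfl
  | one => exact ⟨1, map_one _⟩
  | mul x y hx hy h1 h2 =>
    obtain ⟨w1, h1⟩ := h1
    obtain ⟨w2, h2⟩ := h2
    exact ⟨w1 * w2, by rw [map_mul, h1, h2]; rfl⟩

/-- The induced bijection `Π' → Π` of simple roots. -/
def IsCentralIsogeny.baseEquiv (hf : IsCentralIsogeny b' b f) : b'.support ≃ b.support :=
  f.indexEquiv.subtypeEquiv fun i => (hf.map_base i).symm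

lemma IsCentralIsogeny.weylLength_weylMap (hf : IsCentralIsogeny b' b f) (w : P'.weylGroup) :
    weylLength b (hf.weylMap w) = weylLength b' w := by
  have key : ∀ l : List b'.support,
      hf.weylMap ((l.map fun i : b'.support => RootPairing.weylGroup.ofIdx P' i).prod) =
      ((l.map hf.baseEquiv).map fun i : b.support => RootPairing.weylGroup.ofIdx P i).prod := by
    intro l
    rw [map_list_prod, List.map_map, List.map_map]
    congr 1
    exact List.map_congr_left fun i _ => hf.weylMap_ofIdx i
  unfold weylLength
  congr 1
  ext n
  constructor
  · rintro ⟨l, rfl, hl⟩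
    refine ⟨l.map hf.baseEquiv.symm, by simp, hf.weylMap_injective ?_⟩
    rw [key, ← hl, List.map_map]
    simp
  · rintro ⟨l, rfl, hl⟩
    exact ⟨l.map hf.baseEquiv, by simp, by rw [← key, hl]⟩

lemma root_weylMap (hf : IsCentralIsogeny b' b f) (w : P'.weylGroup) (i : ι') :
    P.weylGroupToPerm (hf.weylMap w) (f.indexEquiv i) = f.indexEquiv (P'.weylGroupToPerm w i) := by
  apply P.root.injective
  rw [← RootPairing.weylGroup_apply_root, ← f.root_weightMap_apply, ← hf.weightMap_smul,
    RootPairing.weylGroup_apply_root, f.root_weightMap_apply]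

/-- The parameter function on `Φ'` corresponding to one on `Φ` under the bijection `Φ' ≃ Φ`. -/
def ParameterFunction.pullback (q : ParameterFunction P I) (hf : IsCentralIsogeny b' b f) :
    ParameterFunction P' I where
  toFun i := q.toFun (f.indexEquiv i)
  map_weyl w j := by rw [← root_weylMap hf, q.map_weyl]

/-- The image `a'` of `a` under the map of complex tori induced by `X' → X`. -/
def TorusPoint.map (a : TorusPoint X I) (f : RootPairing.Hom P' P) : TorusPoint X' I where
  s := a.s.comp (AddMonoidHom.toMultiplicative f.weightMap.toAddMonoidHom)
  t := a.t

/-- The homomorphism `𝒜[X'] → 𝒜[X]`. -/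
def latMap (I : Type*) (f : RootPairing.Hom P' P) :
    LatticeAlgebra I X' →ₐ[LaurentRing I] LatticeAlgebra I X :=
  AddMonoidAlgebra.mapDomainAlgHom _ _ f.weightMap.toAddMonoidHom

lemma latMap_latExp (f : RootPairing.Hom P' P) (x : X') :
    latMap I f (latExp I x) = latExp I (f.weightMap x) := by
  simp [latMap, latExp]

lemma latMap_bernsteinQuotient (f : RootPairing.Hom P' P) (i : ι') (x : X') :
    latMap I f (bernsteinQuotient P' I i x) =
      bernsteinQuotient P I (f.indexEquiv i) (f.weightMap x) := by
  simp only [bernsteinQuotient, map_sub, map_sum, latMap_latExp, coroot'_weightMap,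
    weightMap_reflection, map_nsmul, f.root_weightMap_apply]

lemma latToHecke_latExp (b : P.Base) (q : ParameterFunction P I) (x : X) :
    latToHecke b q (latExp I x) = heckeE b q x := by
  simp [latToHecke, latExp]

lemma heckeMk_freeLin (b : P.Base) (q : ParameterFunction P I) (z : LatticeAlgebra I X) :
    heckeMk b q (freeLin P I z) = latToHecke b q z := by
  rw [latToHecke, AddMonoidAlgebra.lift_apply, freeLin, Finsupp.sum, map_sum]
  simp only [map_smul]
  rfl

/-- The homomorphism from the free algebra sending `T_{w'}` to `T_w` and `e^{x'}` to `e^{f(x')}`. -/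
def freeHeckeMap (q : ParameterFunction P I) (hf : IsCentralIsogeny b' b f) :
    FreeHecke P' I →ₐ[LaurentRing I] AffineHecke b q :=
  FreeAlgebra.lift _
    (Sum.elim (fun w => heckeT b q (hf.weylMap w)) fun x => heckeE b q (f.weightMap x))

lemma freeHeckeMap_T (q : ParameterFunction P I) (hf : IsCentralIsogeny b' b f)
    (w : P'.weylGroup) : freeHeckeMap q hf (freeT I w) = heckeT b q (hf.weylMap w) := by
  simp [freeHeckeMap, freeT]

lemma freeHeckeMap_E (q : ParameterFunction P I) (hf : IsCentralIsogeny b' b f)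
    (x : X') : freeHeckeMap q hf (freeE P' I x) = heckeE b q (f.weightMap x) := by
  simp [freeHeckeMap, freeE]

lemma freeHeckeMap_freeLin (q : ParameterFunction P I) (hf : IsCentralIsogeny b' b f)
    (z : LatticeAlgebra I X') :
    freeHeckeMap q hf (freeLin P' I z) = latToHecke b q (latMap I f z) := by
  have h : (latToHecke b q).comp (latMap I f) = AddMonoidAlgebra.lift (LaurentRing I) _ X'
      (((latToHecke b q).comp (latMap I f) : LatticeAlgebra I X' →* AffineHecke b q).comp
        (AddMonoidAlgebra.of _ X')) := by
    ext; simp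
  rw [← AlgHom.comp_apply, h, AddMonoidAlgebra.lift_apply, freeLin, Finsupp.sum, map_sum]
  refine Finset.sum_congr rfl fun x _ => ?_
  rw [map_smul, freeHeckeMap_E, ← latToHecke_latExp, ← latMap_latExp]
  rfl

lemma freeHeckeMap_rel (q : ParameterFunction P I) (hf : IsCentralIsogeny b' b f)
    ⦃x y : FreeHecke P' I⦄ (h : HeckeRel b' (q.pullback hf) x y) :
    freeHeckeMap q hf x = freeHeckeMap q hf y := by
  cases h with
  | T_one =>
    rw [freeHeckeMap_T, map_one, map_one, heckeT, heckeMk_rel HeckeRel.T_one, map_one]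
  | E_zero =>
    rw [freeHeckeMap_E, map_zero, map_one, heckeE, heckeMk_rel HeckeRel.E_zero, map_one]
  | quadratic i hi =>
    have := heckeMk_rel (HeckeRel.quadratic (q := q) (f.indexEquiv i) ((hf.map_base i).2 hi))
    rw [map_mul, map_add, map_smul, AlgHom.commutes] at this ⊢
    rw [freeHeckeMap_T, hf.weylMap_ofIdx]
    exact this
  | T_mul w w' h =>
    have := heckeMk_rel (HeckeRel.T_mul (q := q) (b := b) (hf.weylMap w) (hf.weylMap w') (by
      rw [← map_mul, hf.weylLength_weylMap, hf.weylLength_weylMap, hf.weylLength_weylMap, h]))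
    rw [map_mul, freeHeckeMap_T, freeHeckeMap_T, freeHeckeMap_T, map_mul]
    rw [map_mul] at this
    exact this
  | E_add x y =>
    have := heckeMk_rel (HeckeRel.E_add (q := q) (b := b) (f.weightMap x) (f.weightMap y))
    rw [map_mul, freeHeckeMap_E, freeHeckeMap_E, freeHeckeMap_E, map_add]
    rw [map_mul] at this
    exact this
  | bernstein i hi x =>
    have := heckeMk_rel (HeckeRel.bernstein (q := q) (f.indexEquiv i) ((hf.map_base i).2 hi)
      (f.weightMap x))
    rw [map_sub, map_mul, map_mul, map_smul, heckeMk_freeLin] at this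
    rw [map_sub, map_mul, map_mul, map_smul, freeHeckeMap_freeLin, freeHeckeMap_T, freeHeckeMap_E,
      freeHeckeMap_E, hf.weylMap_ofIdx, weightMap_reflection, latMap_bernsteinQuotient]
    exact this

/-- The canonical map `ℋ'^aff → ℋ^aff` with `T_{w'} ↦ T_w` and `e^{x'} ↦ e^{f(x')}`. -/
def heckeMap (q : ParameterFunction P I) (hf : IsCentralIsogeny b' b f) :
    AffineHecke b' (q.pullback hf) →ₐ[LaurentRing I] AffineHecke b q :=
  RingQuot.liftAlgHom (LaurentRing I) ⟨freeHeckeMap q hf, freeHeckeMap_rel q hf⟩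

lemma heckeMap_heckeMk (q : ParameterFunction P I) (hf : IsCentralIsogeny b' b f)
    (x : FreeHecke P' I) :
    heckeMap q hf (heckeMk b' (q.pullback hf) x) = freeHeckeMap q hf x :=
  RingQuot.liftAlgHom_mkAlgHom_apply _ _ _ _

theorem heckeMap_T (q : ParameterFunction P I) (hf : IsCentralIsogeny b' b f)
    (w : P'.weylGroup) :
    heckeMap q hf (heckeT b' (q.pullback hf) w) = heckeT b q (hf.weylMap w) := by
  rw [heckeT, heckeMap_heckeMk, freeHeckeMap_T]

theorem heckeMap_E (q : ParameterFunction P I) (hf : IsCentralIsogeny b' b f) (x : X') :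
    heckeMap q hf (heckeE b' (q.pullback hf) x) = heckeE b q (f.weightMap x) := by
  rw [heckeE, heckeMap_heckeMk, freeHeckeMap_E]

lemma heckeMap_latToHecke (q : ParameterFunction P I) (hf : IsCentralIsogeny b' b f)
    (z : LatticeAlgebra I X') :
    heckeMap q hf (latToHecke b' (q.pullback hf) z) = latToHecke b q (latMap I f z) := by
  rw [← heckeMk_freeLin, heckeMap_heckeMk, freeHeckeMap_freeLin]

lemma isWeylInvariant_latMap (hf : IsCentralIsogeny b' b f) {z : LatticeAlgebra I X'}
    (hz : IsWeylInvariant P' z) : IsWeylInvariant P (latMap I f z) := by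
  intro w
  obtain ⟨w, rfl⟩ := hf.weylMap_surjective w
  have h1 : latMap I f z = AddMonoidAlgebra.mapDomain f.weightMap z := rfl
  rw [h1]
  conv_rhs => rw [← hz w]
  have h2 : (fun x => hf.weylMap w • x) ∘ f.weightMap = f.weightMap ∘ fun x => w • x :=
    funext fun x => (hf.weightMap_smul w x).symm
  apply AddMonoidAlgebra.coeff_injective
  simp only [AddMonoidAlgebra.coeff_mapDomain, ← Finsupp.mapDomain_comp, h2]

lemma eval_latMap (a : TorusPoint X I) (f : RootPairing.Hom P' P) (z : LatticeAlgebra I X') :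
    a.eval (latMap I f z) = (a.map f).eval z := by
  have : a.eval.comp (latMap I f : LatticeAlgebra I X' →+* LatticeAlgebra I X) =
      (a.map f).eval := by
    apply AddMonoidAlgebra.ringHom_ext
    · intro r
      simp [TorusPoint.eval, latMap, TorusPoint.map]
    · intro x
      simp [TorusPoint.eval, latMap, TorusPoint.map]
  exact RingHom.congr_fun this z

/-- The canonical map after extension of scalars from `ℤ` to `ℂ`. -/
def complexHeckeMap (q : ParameterFunction P I) (hf : IsCentralIsogeny b' b f) :
    ℂ ⊗[ℤ] AffineHecke b' (q.pullback hf) →ₐ[ℂ] ℂ ⊗[ℤ] AffineHecke b q :=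
  Algebra.TensorProduct.map (AlgHom.id ℂ ℂ) (heckeMap q hf : _ →+* _).toIntAlgHom

lemma complexHeckeMap_rel (q : ParameterFunction P I) (hf : IsCentralIsogeny b' b f)
    (a : TorusPoint X I) ⦃u v : ℂ ⊗[ℤ] AffineHecke b' (q.pullback hf)⦄
    (h : CentralRel b' (q.pullback hf) (a.map f) u v) :
    (specMk b q a).comp (complexHeckeMap q hf) u =
      (specMk b q a).comp (complexHeckeMap q hf) v := by
  obtain ⟨z, hz, rfl, rfl⟩ := h
  have h1 : complexHeckeMap q hf ((1 : ℂ) ⊗ₜ[ℤ] latToHecke b' (q.pullback hf) z) =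
      (1 : ℂ) ⊗ₜ[ℤ] latToHecke b q (latMap I f z) := by
    rw [← heckeMap_latToHecke]; rfl
  have h2 : specMk b q a ((1 : ℂ) ⊗ₜ[ℤ] latToHecke b q (latMap I f z)) =
      specMk b q a (algebraMap ℂ _ (a.eval (latMap I f z))) :=
    RingQuot.mkAlgHom_rel ℂ ⟨latMap I f z, isWeylInvariant_latMap hf hz, rfl, rfl⟩
  rw [AlgHom.comp_apply, h1, h2, eval_latMap, AlgHom.commutes, AlgHom.commutes]

/-- The canonical map `ℋ'^aff_{χ_{a'}} → ℋ^aff_{χ_a}`. -/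
def specHeckeMap (q : ParameterFunction P I) (hf : IsCentralIsogeny b' b f) (a : TorusPoint X I) :
    SpecHecke b' (q.pullback hf) (a.map f) →ₐ[ℂ] SpecHecke b q a :=
  RingQuot.liftAlgHom ℂ
    ⟨(specMk b q a).comp (complexHeckeMap q hf), complexHeckeMap_rel q hf a⟩

theorem specHeckeMap_specMk (q : ParameterFunction P I) (hf : IsCentralIsogeny b' b f)
    (a : TorusPoint X I) (u : ℂ ⊗[ℤ] AffineHecke b' (q.pullback hf)) :
    specHeckeMap q hf a (specMk b' (q.pullback hf) (a.map f) u) =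
      specMk b q a (complexHeckeMap q hf u) :=
  RingQuot.liftAlgHom_mkAlgHom_apply _ _ _ _

end Isogeny

end AffHecke

end

noncomputable section

namespace AffHecke

/-! ### Simple reflections, reduced words and the Bernstein quotient. -/

section WeylGroup

variable {ι X Y : Type*} [AddCommGroup X] [AddCommGroup Y] {P : RootDatum ι X Y}

/-! The idea is that at a positive real point the missing elements `e^x`, `x ∈ X`, can be recovered
inside the smaller algebra as positive roots. Let `N` be the order of the cokernel of `f`, so that
`N x` lies in `f(X')` for all `x ∈ X`. In the smaller specialized algebra each `e^{x'}` is
annihilated by `∏_w (T - s(f(w x')))`, whose roots are positive. Such an element has a spectrally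
positive `N`-th root, polynomial in it, and commuting spectrally positive elements with equal `N`-th
powers coincide. This yields a multiplicative family `θ : X → ℋ'_{χ_{a'}}` extending `x' ↦ e^{x'}`
(`exists_root_extension`).

The family `θ` still satisfies the Bernstein relation (`bernstein_root_extension`): the defect is a
twisted derivation vanishing on `f(X')`, and comparing its values at `x` and `N x` gives a Sylvester
equation whose only solution is zero by positivity. Consequently the `W`-invariants evaluated
through `θ` are central (`latEval_root_extension_commute`).

Two consequences give the theorem. The canonical map sends `θ(x)` to a positive `N`-th root of `e^{N
x}`, which must be `e^x`; hence the map is surjective (`specHeckeMap_surjective`), so restriction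
preserves simplicity and is injective on isomorphism classes. Conversely, on a simple module of the
smaller algebra the operators `θ(x)` have a joint eigenvector. Its weight is a Weyl conjugate of
`s`, so the invariants act on it through `χ_a`; being central, they do so on the whole module. The
universal property of `ℋ_{χ_a}` then extends the action (`exists_extension`). -/

lemma isTorsionFree_weight (P : RootDatum ι X Y) : Module.IsTorsionFree ℤ X := by
  have : Module.IsReflexive ℤ X := .of_isPerfPair P.toLinearMap
  infer_instance

lemma isTorsionFree_coweight (P : RootDatum ι X Y) : Module.IsTorsionFree ℤ Y :=
  isTorsionFree_weight P.flip

lemma weyl_smul_sub_mem_rootSpan (w : P.weylGroup) (x : X) : w • x - x ∈ P.rootSpan ℤ := by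
  obtain ⟨w, hw⟩ := w
  induction hw using RootPairing.weylGroup.induction generalizing x with
  | mem i =>
    change P.reflection i x - x ∈ _
    rw [RootPairing.reflection_apply, sub_sub_cancel_left]
    exact neg_mem (Submodule.smul_mem _ _ (Submodule.subset_span ⟨i, rfl⟩))
  | one =>
    have : (⟨1, P.weylGroup.one_mem⟩ : P.weylGroup) • x = x := one_smul P.weylGroup x
    simp [this]
  | mul u v hu hv h1 h2 =>
    have : (⟨u * v, mul_mem hu hv⟩ : P.weylGroup) • x
      = (⟨u, hu⟩ : P.weylGroup) • (⟨v, hv⟩ : P.weylGroup) • x := mul_smul (⟨u, hu⟩ : P.weylGroup) ⟨v, hv⟩ x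
    rw [this]
    simpa using add_mem (h1 ((⟨v, hv⟩ : P.weylGroup) • x)) (h2 x)

/-- If `w` fixes every root, then `w x` and `x` pair equally with every coroot. So `w x - x`, which
lies in the root span, is isotropic for the root form, and that form is anisotropic there. -/
lemma weylGroupToPerm_injective [Finite ι] (P : RootDatum ι X Y) :
    Function.Injective P.weylGroupToPerm := by
  rw [injective_iff_map_eq_one]
  intro w hw
  apply weyl_ext
  intro x
  rw [one_smul, ← sub_eq_zero]
  have := Fintype.ofFinite ι
  apply P.eq_zero_of_mem_rootSpan_of_rootForm_self_eq_zero (weyl_smul_sub_mem_rootSpan w x)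
  rw [RootPairing.rootForm_apply_apply]
  refine Finset.sum_eq_zero fun i _ => ?_
  have h := coroot'_weightMap (w : RootPairing.Aut P).toHom i x
  have h2 : (w : RootPairing.Aut P).toHom.indexEquiv i = i := congrArg (fun e => e i) hw
  rw [h2] at h
  rw [map_sub, weyl_smul_eq, h, sub_self, zero_mul]

lemma finite_weylGroup [Finite ι] (P : RootDatum ι X Y) : Finite P.weylGroup :=
  Finite.of_injective _ (weylGroupToPerm_injective P)

/-- A positive root other than the simple root `j` is not a multiple of it, so some other simple
root has a positive coefficient. Reflection in `j` leaves that coefficient alone, and the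
coefficients of a root all have the same sign. -/
lemma isPos_reflectionPerm [Finite ι] (b : P.Base) {i j : ι} (hi : b.IsPos i) (hj : j ∈ b.support)
    (hij : i ≠ j) : b.IsPos (P.reflectionPerm j i) := by
  classical
  have := isTorsionFree_weight P
  have := isTorsionFree_coweight P
  obtain ⟨f, hf₀, hf₁, hf₂⟩ := b.exists_root_eq_sum_int i
  have hpos : 0 < f := by
    refine hf₁.resolve_right fun hneg => ?_
    rw [RootPairing.Base.isPos_iff, RootPairing.Base.height_eq_sum hf₂] at hi
    exact absurd (Finset.sum_nonpos fun l _ => hneg.le l) hi.not_ge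
  obtain ⟨l, hl, hlj, hfl⟩ : ∃ l ∈ b.support, l ≠ j ∧ 0 < f l := by
    by_contra! hcon
    have h0 : ∀ l ∈ b.support, l ≠ j → f l = 0 := fun l hl hlj => le_antisymm (hcon l hl hlj) (hpos.le l)
    have h1 : P.root i = f j • P.root j := by
      rw [hf₂]
      exact Finset.sum_eq_single_of_mem j hj fun l hl hlj => by rw [h0 l hl hlj, zero_smul]
    have hX : IsAddTorsionFree X := .of_isTorsionFree ℤ X
    have hY : IsAddTorsionFree Y := .of_isTorsionFree ℤ Y
    rcases b.eq_one_or_neg_one_of_mem_support_of_smul_mem j hj (f j) ⟨i, h1⟩ with h | h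
    · rw [h, one_smul] at h1
      exact hij (P.root.injective h1)
    · have := hpos.le j
      rw [h] at this
      simp at this
  set z : ℤ := -P.pairing i j
  have hk : P.root (P.reflectionPerm j i) = ∑ m ∈ b.support, (f + Pi.single j z : ι → ℤ) m • P.root m := by
    rw [RootPairing.root_reflectionPerm, RootPairing.reflection_apply_root]
    simp only [Pi.add_apply, add_smul, Finset.sum_add_distrib, ← hf₂]
    rw [Finset.sum_eq_single_of_mem j hj fun m _ hm => by rw [Pi.single_eq_of_ne hm, zero_smul],
      Pi.single_eq_same, neg_smul, sub_eq_add_neg]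
  have hsupp : Function.support (f + Pi.single j z : ι → ℤ) ⊆ b.support := by
    intro m hm
    by_contra hmb
    refine hm ?_
    rw [Pi.add_apply, Pi.single_eq_of_ne (by rintro rfl; exact hmb hj), add_zero]
    exact Function.notMem_support.1 fun h => hmb (hf₀ h)
  rw [RootPairing.Base.isPos_iff', RootPairing.Base.height_eq_sum hk]
  rcases b.pos_or_neg_of_sum_smul_root_mem _ ⟨_, hk⟩ hsupp with h | h
  · exact Finset.sum_nonneg fun m _ => h.le m
  · have h3 := h.le l
    rw [Pi.add_apply, Pi.single_eq_of_ne hlj, add_zero] at h3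
    exact absurd h3 hfl.not_ge

lemma ofIdx_reflectionPerm (P : RootDatum ι X Y) (i j : ι) :
    RootPairing.weylGroup.ofIdx P (P.reflectionPerm j i) = RootPairing.weylGroup.ofIdx P j *
      RootPairing.weylGroup.ofIdx P i * RootPairing.weylGroup.ofIdx P j := by
  apply weyl_ext
  intro x
  simp only [mul_smul, ofIdx_smul_eq, RootPairing.reflection_reflectionPerm]
  rfl

lemma ofIdx_mul_self (P : RootDatum ι X Y) (i : ι) :
    RootPairing.weylGroup.ofIdx P i * RootPairing.weylGroup.ofIdx P i = 1 := by
  apply weyl_ext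
  intro x
  rw [mul_smul, ofIdx_smul_eq, ofIdx_smul_eq, RootPairing.reflection_same, one_smul]

/-- Simple reflections generate the reflections of positive roots. -/
lemma ofIdx_mem_closure_of_isPos [Finite ι] (b : P.Base) {i : ι} (hi : b.IsPos i) :
    RootPairing.weylGroup.ofIdx P i ∈
      Submonoid.closure (Set.range fun i : b.support => RootPairing.weylGroup.ofIdx P i) := by
  generalize hN : (b.height i).toNat = N
  induction N using Nat.strongRecOn generalizing i with
  | ind n ih =>
    -- Reflecting in a simple root that pairs positively with `i` lowers the height, and it
    -- conjugates the reflection of `i` into that of a lower positive root.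
    obtain ⟨j, hj, hj'⟩ := hi.exists_mem_support_pos_pairingIn
    rw [P.zero_lt_pairingIn_iff'] at hj'
    have hsj := Submonoid.subset_closure
      (s := Set.range fun i : b.support => RootPairing.weylGroup.ofIdx P i) ⟨⟨j, hj⟩, rfl⟩
    rcases eq_or_ne i j with rfl | hij
    · exact hsj
    have hk := isPos_reflectionPerm b hi hj hij
    have hlt : b.height (P.reflectionPerm j i) < b.height i := by
      have := P.reflection_apply_root' ℤ (i := j) (j := i)
      rw [← RootPairing.root_reflectionPerm, sub_eq_add_neg, ← neg_smul] at this
      rw [b.height_add_zsmul this, RootPairing.Base.height_one_of_mem_support hj]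
      simp
      exact hj'
    have := ih _ (by rw [RootPairing.Base.isPos_iff] at hk hi; omega) hk rfl
    have h2 := ofIdx_reflectionPerm P (P.reflectionPerm j i) j
    rw [RootPairing.reflectionPerm_self] at h2
    rw [h2]
    exact mul_mem (mul_mem hsj this) hsj

/-- The simple reflections generate the Weyl group. -/
lemma mem_closure_simple [Finite ι] (b : P.Base) (w : P.weylGroup) :
    w ∈ Submonoid.closure (Set.range fun i : b.support => RootPairing.weylGroup.ofIdx P i) := by
  obtain ⟨w, hw⟩ := w
  induction hw using RootPairing.weylGroup.induction with
  | mem i =>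
    let := P.indexNeg
    rcases RootPairing.Base.IsPos.or_neg b i with hi | hi
    · exact ofIdx_mem_closure_of_isPos b hi
    -- A root and its negative define the same reflection.
    · have h := ofIdx_reflectionPerm P i i
      rw [ofIdx_mul_self, one_mul] at h
      change RootPairing.weylGroup.ofIdx P i ∈ _
      rw [← h]
      exact ofIdx_mem_closure_of_isPos b hi
  | one => exact one_mem _
  | mul u v hu hv h1 h2 => exact mul_mem h1 h2

lemma exists_word [Finite ι] (b : P.Base) (w : P.weylGroup) :
    ∃ l : List b.support, l.length = weylLength b w ∧
      (l.map fun i : b.support => RootPairing.weylGroup.ofIdx P i).prod = w := by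
  refine Nat.sInf_mem (s := {n | ∃ l : List b.support,
    l.length = n ∧ (l.map fun i : b.support => RootPairing.weylGroup.ofIdx P i).prod = w}) ?_
  obtain ⟨l, hl, rfl⟩ := Submonoid.exists_list_of_mem_closure (mem_closure_simple b w)
  obtain ⟨m, rfl⟩ := (Set.range_list_map _).ge hl
  exact ⟨_, m, rfl, rfl⟩

lemma weylLength_le (b : P.Base) (l : List b.support) :
    weylLength b (l.map fun i : b.support => RootPairing.weylGroup.ofIdx P i).prod ≤ l.length :=
  Nat.sInf_le ⟨l, rfl, rfl⟩

lemma weylLength_mul_le [Finite ι] (b : P.Base) (w w' : P.weylGroup) :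
    weylLength b (w * w') ≤ weylLength b w + weylLength b w' := by
  obtain ⟨l, hl, h⟩ := exists_word b w
  obtain ⟨l', hl', h'⟩ := exists_word b w'
  have := weylLength_le b (l ++ l')
  rwa [List.map_append, List.prod_append, h, h', List.length_append, hl, hl'] at this

/-- Induction along reduced words. -/
lemma weyl_length_induction [Finite ι] (b : P.Base) {p : P.weylGroup → Prop} (one : p 1)
    (mul : ∀ i ∈ b.support, ∀ w, weylLength b (RootPairing.weylGroup.ofIdx P i * w) =
      weylLength b (RootPairing.weylGroup.ofIdx P i) + weylLength b w → p w →
      p (RootPairing.weylGroup.ofIdx P i * w)) (w : P.weylGroup) : p w := by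
  obtain ⟨l, hl, h⟩ := exists_word b w
  induction l generalizing w with
  | nil => simpa [← h] using one
  | cons i l ih =>
    rw [List.map_cons, List.prod_cons] at h
    set w' := (l.map fun i : b.support => RootPairing.weylGroup.ofIdx P i).prod with hw'
    -- The tail of a reduced word is reduced: subadditivity of the length forces equality in the
    -- bounds `h1` and `h2`.
    have h1 : weylLength b w' ≤ l.length := weylLength_le b l
    have h2 : weylLength b (RootPairing.weylGroup.ofIdx P i) ≤ 1 := by
      simpa using weylLength_le b [i]
    have h3 := weylLength_mul_le b (RootPairing.weylGroup.ofIdx P i) w'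
    rw [h, ← hl, List.length_cons] at h3
    rw [← h]
    refine mul i i.2 w' ?_ (ih w' ?_ rfl)
    · rw [h, ← hl, List.length_cons]; omega
    · omega

lemma noZeroDivisors_latticeAlgebra [Module.Finite ℤ X] (P : RootDatum ι X Y) (I : Type*) :
    NoZeroDivisors (LatticeAlgebra I X) := by
  have := isTorsionFree_weight P
  have : Module.Free ℤ X := inferInstance
  have : TwoUniqueSums X := TwoUniqueSums.of_injective_addHom
    (Module.Free.chooseBasis ℤ X).repr.toAddEquiv.toAddHom
    (Module.Free.chooseBasis ℤ X).repr.injective inferInstance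
  infer_instance

lemma one_sub_latExp_neg_root_ne_zero (P : RootDatum ι X Y) (I : Type*) (i : ι) :
    1 - latExp I (-P.root i) ≠ 0 := by
  have := isTorsionFree_weight P
  intro h
  rw [sub_eq_zero, ← latExp_zero] at h
  have h3 : (0 : X) = -P.root i := AddMonoidAlgebra.single_left_injective one_ne_zero h
  exact P.ne_zero i (by simpa using h3.symm)

/-- A twisted Leibniz rule, checked after multiplying by `1 - e^{-α}`, which may be cancelled
because `𝒜[X]` is a domain. It later makes the defect of the Bernstein relation a twisted
derivation. -/
lemma bernsteinQuotient_add [Module.Finite ℤ X] (P : RootDatum ι X Y) (I : Type*) (i : ι)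
    (x y : X) : bernsteinQuotient P I i (x + y) = latExp I x * bernsteinQuotient P I i y +
      bernsteinQuotient P I i x * latExp I (P.reflection i y) := by
  have := noZeroDivisors_latticeAlgebra P I
  apply mul_left_cancel₀ (one_sub_latExp_neg_root_ne_zero P I i)
  rw [mul_add, mul_left_comm, ← mul_assoc (1 - _) (bernsteinQuotient P I i x),
    one_sub_mul_bernsteinQuotient, one_sub_mul_bernsteinQuotient, one_sub_mul_bernsteinQuotient,
    map_add, latExp_add, latExp_add]
  ring

lemma bernsteinQuotient_reflection (P : RootDatum ι X Y) (I : Type*) (i : ι) (x : X) :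
    bernsteinQuotient P I i (P.reflection i x) = -bernsteinQuotient P I i x := by
  have h : P.coroot' i (P.reflection i x) = -P.coroot' i x := by
    rw [RootPairing.reflection_apply, map_sub, map_smul, RootPairing.root_coroot'_eq_pairing,
      RootPairing.pairing_same, smul_eq_mul]
    ring
  simp only [bernsteinQuotient, h, neg_neg, RootPairing.reflection_same, neg_sub]

lemma bernsteinQuotient_zero (P : RootDatum ι X Y) (I : Type*) (i : ι) :
    bernsteinQuotient P I i 0 = 0 := by
  simp [bernsteinQuotient]

end WeylGroup

/-! ### Elements with positive spectrum and their roots. -/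

section PositiveSpectrum

open Polynomial
open scoped ComplexOrder

variable {A B : Type*} [Ring A] [Algebra ℂ A] [Ring B] [Algebra ℂ B]
variable {V : Type*} [AddCommGroup V] [Module ℂ V]

/-- An element of a complex algebra is spectrally positive if it is annihilated by a nonzero
polynomial all of whose roots are positive real numbers. -/
def IsSpecPos (a : A) : Prop :=
  ∃ p : ℂ[X], p ≠ 0 ∧ (∀ z, p.IsRoot z → 0 < z) ∧ aeval a p = 0

lemma IsSpecPos.map {a : A} (h : IsSpecPos a) (φ : A →ₐ[ℂ] B) : IsSpecPos (φ a) := by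
  obtain ⟨p, h0, h1, h2⟩ := h
  exact ⟨p, h0, h1, by rw [aeval_algHom_apply, h2, map_zero]⟩

lemma isSpecPos_one : IsSpecPos (1 : A) :=
  ⟨X - C 1, X_sub_C_ne_zero 1, fun z hz => by
    rw [← root_X_sub_C.1 hz]; exact one_pos, by simp⟩

/-- Right multiplication reverses products, so `IsSpecPos.map` does not apply directly; on
polynomials in the single element `a` the order is irrelevant. -/
lemma IsSpecPos.mulRight {a : A} (h : IsSpecPos a) : IsSpecPos (LinearMap.mulRight ℂ a) := by
  obtain ⟨p, h0, h1, h2⟩ := h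
  refine ⟨p, h0, h1, ?_⟩
  have : ∀ p : ℂ[X], aeval (LinearMap.mulRight ℂ a) p = LinearMap.mulRight ℂ (aeval a p) := by
    intro p
    induction p using Polynomial.induction_on' with
    | add p q hp hq =>
      ext x
      simp [hp, hq, mul_add]
    | monomial n c =>
      ext x
      simp [aeval_monomial, LinearMap.pow_mulRight, Algebra.algebraMap_eq_smul_one]
  rw [this, h2, LinearMap.mulRight_zero_eq_zero]

lemma IsSpecPos.mulLeft {a : A} (h : IsSpecPos a) : IsSpecPos (LinearMap.mulLeft ℂ a) :=
  h.map (Algebra.lmul ℂ A)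

/-- A spectrally positive operator has an eigenvector with positive eigenvalue in each nonzero
invariant subspace. -/
lemma IsSpecPos.exists_eigenvector {a : Module.End ℂ V} (h : IsSpecPos a) {K : Submodule ℂ V}
    (hK : ∀ v ∈ K, a v ∈ K) {v : V} (hv : v ∈ K) (hv0 : v ≠ 0) :
    ∃ u ∈ K, u ≠ 0 ∧ ∃ c : ℂ, 0 < c ∧ a u = c • u := by
  obtain ⟨p, h0, h1, h2⟩ := h
  have key : ∀ s : Multiset ℂ, (∀ z ∈ s, 0 < z) → ∀ v ∈ K, v ≠ 0 →
      aeval a (s.map fun z => X - C z).prod v = 0 →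
      ∃ u ∈ K, u ≠ 0 ∧ ∃ c : ℂ, 0 < c ∧ a u = c • u := by
    intro s
    induction s using Multiset.induction with
    | empty => intro _ v _ hv0 h; simp at h; exact absurd h hv0
    | cons z s ih =>
      intro hs v hv hv0 h
      -- Linear factors are applied to `v` one at a time; the last nonzero vector before the product
      -- vanishes is an eigenvector.
      by_cases hu : a v - z • v = 0
      · exact ⟨v, hv, hv0, z, hs z (by simp), sub_eq_zero.1 hu⟩
      · refine ih (fun z hz => hs z (by simp [hz])) (a v - z • v)
          (sub_mem (hK v hv) (K.smul_mem z hv)) hu ?_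
        rw [Multiset.map_cons, Multiset.prod_cons, mul_comm, map_mul] at h
        simpa [Module.algebraMap_end_apply] using h
  have hp := (IsAlgClosed.splits p).eq_prod_roots
  refine key p.roots (fun z hz => h1 z (isRoot_of_mem_roots hz)) v hv hv0 ?_
  rw [hp, map_mul, aeval_C] at h2
  have h3 := LinearMap.congr_fun h2 v
  rw [Module.End.mul_apply, Module.algebraMap_end_apply, LinearMap.zero_apply, smul_eq_zero] at h3
  exact h3.resolve_left (leadingCoeff_ne_zero.2 h0)

/-- Commuting spectrally positive operators have joint eigenvectors. -/
lemma exists_joint_eigenvector {κ : Type*} (T : κ → Module.End ℂ V) (hT : ∀ i, IsSpecPos (T i))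
    (hc : ∀ i j, Commute (T i) (T j)) {K : Submodule ℂ V} (hK : ∀ i, ∀ v ∈ K, T i v ∈ K)
    (hK0 : K ≠ ⊥) (s : Finset κ) :
    ∃ u ∈ K, u ≠ 0 ∧ ∀ i ∈ s, ∃ c : ℂ, 0 < c ∧ T i u = c • u := by
  classical
  induction s using Finset.induction_on with
  | empty =>
    obtain ⟨u, hu, hu0⟩ := K.exists_mem_ne_zero_of_ne_bot hK0
    exact ⟨u, hu, hu0, by simp⟩
  | insert j s _ ih =>
    obtain ⟨u, hu, hu0, h⟩ := ih
    choose! c hc0 hcu using h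
    -- Commutation makes this joint eigenspace invariant under `T j`, so the next eigenvector can be
    -- found inside it.
    let L : Submodule ℂ V := K ⊓ ⨅ i ∈ s, (T i).eigenspace (c i)
    have hL : ∀ v, v ∈ L ↔ v ∈ K ∧ ∀ i ∈ s, T i v = c i • v := by
      simp [L, Submodule.mem_iInf]
    obtain ⟨w, hw, hw0, d, hd, hdw⟩ := (hT j).exists_eigenvector (K := L) (fun v hv => by
      rw [hL] at hv ⊢
      refine ⟨hK j v hv.1, fun i hi => ?_⟩
      rw [← Module.End.mul_apply, (hc i j).eq, Module.End.mul_apply, hv.2 i hi, map_smul])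
      ((hL u).2 ⟨hu, hcu⟩) hu0
    rw [hL] at hw
    refine ⟨w, hw.1, hw0, fun i hi => ?_⟩
    rcases Finset.mem_insert.1 hi with rfl | hi
    · exact ⟨d, hd, hdw⟩
    · exact ⟨c i, hc0 i hi, hw.2 i hi⟩

lemma pow_apply_eq_smul {a : Module.End ℂ V} {c : ℂ} {u : V} (h : a u = c • u) (n : ℕ) :
    (a ^ n) u = c ^ n • u := by
  induction n with
  | zero => simp
  | succ n ih => rw [pow_succ, Module.End.mul_apply, h, map_smul, ih, smul_smul, pow_succ']

/-- For commuting spectrally positive operators `a`, `b`, `c`, the operator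
`(a ^ N - (b * c) ^ N) / (a - b * c)` is injective. -/
lemma sum_pow_mul_pow_injective {a b c : Module.End ℂ V} (ha : IsSpecPos a) (hb : IsSpecPos b)
    (hc : IsSpecPos c) (hab : Commute a b) (hac : Commute a c) (hbc : Commute b c) {N : ℕ}
    (hN : N ≠ 0) {v : V}
    (hv : (∑ i ∈ Finset.range N, a ^ i * (b * c) ^ (N - 1 - i)) v = 0) : v = 0 := by
  -- A nonzero kernel of `S` would contain a joint eigenvector of `a`, `b`, `c`, on which `S` acts
  -- by a nonempty sum of positive numbers. Keeping `b` and `c` apart avoids having to show that `b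
  -- * c` is spectrally positive.
  set S : Module.End ℂ V := ∑ i ∈ Finset.range N, a ^ i * (b * c) ^ (N - 1 - i) with hS
  by_contra hv0
  have hcomm : ∀ d : Module.End ℂ V, Commute d a → Commute d b → Commute d c → Commute d S :=
    fun d h1 h2 h3 => Commute.sum_right _ _ _ fun i _ =>
      (h1.pow_right i).mul_right ((h2.mul_right h3).pow_right _)
  have hT : ∀ i : Fin 3, IsSpecPos (![a, b, c] i) ∧ Commute (![a, b, c] i) S := by
    intro i
    fin_cases i
    · exact ⟨ha, hcomm _ (.refl a) hab hac⟩
    · exact ⟨hb, hcomm _ hab.symm (.refl b) hbc⟩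
    · exact ⟨hc, hcomm _ hac.symm hbc.symm (.refl c)⟩
  obtain ⟨u, hu, hu0, h⟩ := exists_joint_eigenvector ![a, b, c] (fun i => (hT i).1)
    (by
      intro i j
      fin_cases i <;> fin_cases j
      exacts [.refl a, hab, hac, hab.symm, .refl b, hbc, hac.symm, hbc.symm, .refl c])
    (K := LinearMap.ker S) (fun i w hw => by
      rw [LinearMap.mem_ker] at hw ⊢
      rw [← Module.End.mul_apply, ← (hT i).2.eq, Module.End.mul_apply, hw, map_zero])
    (fun h => hv0 (by simpa [h] using LinearMap.mem_ker.2 hv)) Finset.univ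
  obtain ⟨x, hx, hxu⟩ := h 0 (by simp)
  obtain ⟨y, hy, hyu⟩ := h 1 (by simp)
  obtain ⟨z, hz, hzu⟩ := h 2 (by simp)
  change a u = _ at hxu
  change b u = _ at hyu
  change c u = _ at hzu
  have hyz : (b * c) u = (y * z) • u := by
    rw [Module.End.mul_apply, hzu, map_smul, hyu, smul_smul, mul_comm]
  have hSu : S u = (∑ i ∈ Finset.range N, x ^ i * (y * z) ^ (N - 1 - i)) • u := by
    rw [hS, LinearMap.sum_apply, Finset.sum_smul]
    refine Finset.sum_congr rfl fun i _ => ?_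
    rw [Module.End.mul_apply, pow_apply_eq_smul hyz, map_smul, pow_apply_eq_smul hxu, smul_smul,
      mul_comm]
  rw [LinearMap.mem_ker.1 hu] at hSu
  refine hu0 ((smul_eq_zero.1 hSu.symm).resolve_left (ne_of_gt ?_))
  exact Finset.sum_pos (fun i _ => mul_pos (pow_pos hx i) (pow_pos (mul_pos hy hz) _))
    (Finset.nonempty_range_iff.2 hN)

/-- Uniqueness of spectrally positive roots. -/
lemma IsSpecPos.eq_mul_of_pow_eq {a b c : A} (ha : IsSpecPos a) (hb : IsSpecPos b)
    (hc : IsSpecPos c) (hab : Commute a b) (hac : Commute a c) (hbc : Commute b c) {N : ℕ}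
    (hN : N ≠ 0) (h : a ^ N = (b * c) ^ N) : a = b * c := by
  rw [← sub_eq_zero]
  -- The geometric sum times `a - b * c` is `a ^ N - (b * c) ^ N = 0`, and left multiplication by
  -- that sum is injective.
  have h2 := ((hab.mul_right hac).geom_sum₂_mul N)
  rw [h, sub_self] at h2
  refine sum_pow_mul_pow_injective (ha.map (Algebra.lmul ℂ A)) (hb.map (Algebra.lmul ℂ A))
    (hc.map (Algebra.lmul ℂ A)) (hab.map _) (hac.map _) (hbc.map _) hN ?_
  simp only [← map_pow, ← map_mul, ← map_sum]
  exact h2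

lemma IsSpecPos.eq_of_pow_eq {a b : A} (ha : IsSpecPos a) (hb : IsSpecPos b)
    (hab : Commute a b) {N : ℕ} (hN : N ≠ 0) (h : a ^ N = b ^ N) : a = b := by
  simpa using ha.eq_mul_of_pow_eq hb isSpecPos_one hab (.one_right a) (.one_right b) hN (by simpa)

/-- A solution of a Sylvester type equation with spectrally positive coefficients is zero. -/
lemma IsSpecPos.eq_zero_of_sum_eq_zero {a b d : A} (ha : IsSpecPos a) (hb : IsSpecPos b) {N : ℕ}
    (hN : N ≠ 0) (h : ∑ i ∈ Finset.range N, a ^ i * d * b ^ (N - 1 - i) = 0) : d = 0 := by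
  -- The sum is the geometric sum of the commuting operators "left multiplication by `a`" and "right
  -- multiplication by `b`", applied to `d`.
  refine sum_pow_mul_pow_injective ha.mulLeft hb.mulRight isSpecPos_one
    (LinearMap.commute_mulLeft_right ..) (.one_right _) (.one_right _) hN ?_
  rw [← h, LinearMap.sum_apply]
  refine Finset.sum_congr rfl fun i _ => ?_
  simp [LinearMap.pow_mulLeft, LinearMap.pow_mulRight, mul_assoc]

lemma exists_real_of_pos {z : ℂ} (hz : 0 < z) : ∃ r : ℝ, 0 < r ∧ (r : ℂ) = z := by
  rw [Complex.lt_def] at hz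
  exact ⟨z.re, hz.1, Complex.ext rfl hz.2⟩

lemma exists_complex_root {z : ℂ} (hz : 0 < z) {N : ℕ} (hN : N ≠ 0) :
    ∃ w : ℂ, 0 < w ∧ w ^ N = z := by
  obtain ⟨r, hr, rfl⟩ := exists_real_of_pos hz
  refine ⟨((r ^ ((N : ℝ)⁻¹) : ℝ) : ℂ), by exact_mod_cast Real.rpow_pos_of_pos hr _, ?_⟩
  exact_mod_cast Real.rpow_inv_natCast_pow hr.le hN

/-- Every linear factor of `p` divides `h`, so `p` divides the power of `h` whose exponent is the
number of roots of `p` with multiplicity. -/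
lemma isNilpotent_aeval_root {p h : ℂ[X]} (hp : p ≠ 0) (hh : ∀ z, p.IsRoot z → h.IsRoot z) :
    IsNilpotent (aeval (AdjoinRoot.root p) h) := by
  refine ⟨p.roots.card, ?_⟩
  have h1 : (p.roots.map fun z => X - C z).prod ∣ h ^ p.roots.card := by
    rw [← Multiset.prod_replicate, ← Multiset.map_const']
    exact Multiset.prod_dvd_prod_of_dvd _ _ fun z hz =>
      dvd_iff_isRoot.2 (hh z (isRoot_of_mem_roots hz))
  have h2 : p ∣ h ^ p.roots.card := by
    nth_rw 1 [(IsAlgClosed.splits p).eq_prod_roots]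
    exact (IsUnit.mul_left_dvd (isUnit_C.2 (leadingCoeff_ne_zero.2 hp).isUnit)).2 h1
  rw [← map_pow, AdjoinRoot.aeval_eq, AdjoinRoot.mk_eq_zero]
  exact h2

lemma isUnit_aeval_root {p h : ℂ[X]} (hh : ∀ z, p.IsRoot z → ¬ h.IsRoot z) :
    IsUnit (aeval (AdjoinRoot.root p) h) := by
  obtain ⟨u, w, huw⟩ : IsCoprime h p := by
    refine (isCoprime_iff_aeval_ne_zero_of_isAlgClosed ℂ ℂ h p).2 fun z => ?_
    by_contra! hz
    exact hh z (by simpa using hz.2) (by simpa using hz.1)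
  have h2 := congrArg (aeval (AdjoinRoot.root p)) huw
  rw [map_add, map_mul, map_mul, AdjoinRoot.aeval_eq p, AdjoinRoot.mk_self, mul_zero, add_zero,
    map_one] at h2
  exact IsUnit.of_mul_eq_one_right _ h2

/-- Existence of spectrally positive roots. -/
lemma IsSpecPos.exists_pow_eq {a : A} (ha : IsSpecPos a) {N : ℕ} (hN : N ≠ 0) :
    ∃ r ∈ Algebra.adjoin ℂ {a}, IsSpecPos r ∧ r ^ N = a := by
  classical
  obtain ⟨p, h0, h1, h2⟩ := ha
  have hν : ∀ z : ℂ, ∃ w : ℂ, 0 < z → 0 < w ∧ w ^ N = z := fun z => by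
    by_cases hz : 0 < z
    · exact (exists_complex_root hz hN).imp fun w hw _ => hw
    · exact ⟨0, fun h => absurd h hz⟩
  choose ν hν using hν
  -- The interpolating polynomial takes each root of `p` to its positive `N`-th root, so `g`
  -- evaluated at the class of the variable is an `N`-th root modulo nilpotents.
  set g := Lagrange.interpolate p.roots.toFinset id ν
  have hg : ∀ z, p.IsRoot z → g.eval z = ν z := fun z hz =>
    Lagrange.eval_interpolate_at_node (v := id) ν Function.injective_id.injOn
      (by simpa [h0] using hz)
  set α := AdjoinRoot.root p
  set x := aeval α g
  -- Newton's method corrects `x` by a nilpotent to an exact root; the derivative `N x ^ (N - 1)` is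
  -- a unit since `ν` does not vanish at the roots of `p`.
  obtain ⟨r, ⟨hr1, hr2⟩, -⟩ := existsUnique_nilpotent_sub_and_aeval_eq_zero
    (P := (X ^ N - C α : (AdjoinRoot p)[X])) (x := x) (by
      have := isNilpotent_aeval_root (h := g ^ N - X) h0 fun z hz => by
        simp [hg z hz, (hν z (h1 z hz)).2]
      rw [map_sub, map_pow, aeval_X] at this
      simpa [-AdjoinRoot.aeval_eq] using this) (by
      have := isUnit_aeval_root (p := p) (h := (N : ℂ[X]) * g ^ (N - 1)) fun z hz => by
        simp [hg z hz, hN, (hν z (h1 z hz)).1.ne']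
      rw [map_mul, map_pow, map_natCast] at this
      simpa [derivative_X_pow, -AdjoinRoot.aeval_eq] using this)
  have hrN : r ^ N = α := by simpa [sub_eq_zero] using hr2
  -- `Q` has only positive roots and is nilpotent at `x`, hence at `r`; a power of it witnesses the
  -- positivity of `r`.
  set Q : ℂ[X] := ∏ z ∈ p.roots.toFinset, (X - C (ν z))
  have hQ : IsNilpotent (aeval r Q) := by
    have hx : IsNilpotent (aeval x Q) := by
      have := isNilpotent_aeval_root (h := Q.comp g) h0 fun z hz => by
        rw [IsRoot.def, eval_comp, hg z hz, eval_prod]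
        exact Finset.prod_eq_zero (i := z) (by simpa [h0] using hz) (by simp)
      rwa [aeval_comp] at this
    obtain ⟨y, hy⟩ := sub_dvd_eval_sub x r (Q.map (algebraMap ℂ (AdjoinRoot p)))
    rw [eval_map_algebraMap, eval_map_algebraMap] at hy
    have : aeval r Q = aeval x Q - (x - r) * y := by rw [← hy]; ring
    rw [this]
    exact (Commute.all _ _).isNilpotent_sub hx ((Commute.all _ _).isNilpotent_mul_right hr1)
  obtain ⟨k, hk⟩ := hQ
  have hQ0 : Q ≠ 0 := Finset.prod_ne_zero_iff.2 fun z _ => X_sub_C_ne_zero _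
  have hrpos : IsSpecPos r := by
    refine ⟨Q ^ k, pow_ne_zero _ hQ0, fun z hz => ?_, by rw [map_pow, hk]⟩
    have hz := eq_zero_of_pow_eq_zero ((eval_pow k).symm.trans hz)
    rw [eval_prod, Finset.prod_eq_zero_iff] at hz
    obtain ⟨w, hw, hz⟩ := hz
    have : z = ν w := by simpa [sub_eq_zero] using hz
    rw [this]
    exact (hν w (h1 w (isRoot_of_mem_roots (Multiset.mem_toFinset.1 hw)))).1
  let φ : AdjoinRoot p →ₐ[ℂ] A := Ideal.Quotient.liftₐ _ (aeval a) (by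
    intro b hb
    obtain ⟨c, rfl⟩ := Ideal.mem_span_singleton'.1 hb
    rw [map_mul, h2, mul_zero])
  have hφ : ∀ h : ℂ[X], φ (AdjoinRoot.mk p h) = aeval a h := fun h => rfl
  refine ⟨φ r, ?_, hrpos.map φ, ?_⟩
  · obtain ⟨h, rfl⟩ := AdjoinRoot.mk_surjective r
    rw [hφ]
    exact aeval_mem_adjoin_singleton ℂ a
  · rw [← map_pow, hrN]
    simpa using hφ X

end PositiveSpectrum

/-! ### Generators, universal property and positivity in the specialized algebra. -/

section Specialization

variable {ι X Y I : Type*} [AddCommGroup X] [AddCommGroup Y] {P : RootDatum ι X Y}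
variable {B : Type*} [Ring B] [Algebra ℂ B]

/-- The ring homomorphism `𝒜[X] → B` extending `θ : X → B` with `q_i ↦ t_i`. -/
def latEval (t : I → ℂˣ) (θ : Multiplicative X →* B) : LatticeAlgebra I X →+* B :=
  AddMonoidAlgebra.liftNCRingHom ((algebraMap ℂ B).comp (evalParam t)) θ
    fun _ _ => Algebra.commutes _ _

lemma latEval_single (t : I → ℂˣ) (θ : Multiplicative X →* B) (x : X) (c : LaurentRing I) :
    latEval t θ (AddMonoidAlgebra.single x c) = evalParam t c • θ (.ofAdd x) := by
  rw [Algebra.smul_def]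
  exact AddMonoidAlgebra.liftNCRingHom_single _ _ _ _ _

lemma latEval_latExp (t : I → ℂˣ) (θ : Multiplicative X →* B) (x : X) :
    latEval t θ (latExp I x) = θ (.ofAdd x) := by
  rw [latExp, latEval_single, map_one, one_smul]

lemma latEval_comp {C : Type*} [Ring C] [Algebra ℂ C] (φ : B →ₐ[ℂ] C) (θ : Multiplicative X →* B)
    (t : I → ℂˣ) (z : LatticeAlgebra I X) :
    latEval t ((φ : B →* C).comp θ) z = φ (latEval t θ z) := by
  have : latEval t ((φ : B →* C).comp θ) = (φ : B →+* C).comp (latEval t θ) := by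
    apply AddMonoidAlgebra.ringHom_ext <;> intro x <;> simp [latEval_single]
  exact RingHom.congr_fun this z

lemma evalParam_qVar (t : I → ℂˣ) (i : I) : evalParam t (qVar i) = t i := by
  have : evalParam t (qVar i) =
      (((Finsupp.single i (1 : ℤ)).prod fun i k => t i ^ k : ℂˣ) : ℂ) := by
    change AddMonoidAlgebra.lift ℤ ℂ (I →₀ ℤ) _ (AddMonoidAlgebra.single _ _) = _
    rw [AddMonoidAlgebra.lift_single, one_smul]
    rfl
  rw [this]
  simp

lemma eval_single (a : TorusPoint X I) (x : X) (c : LaurentRing I) :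
    a.eval (AddMonoidAlgebra.single x c) = evalParam a.t c * a.s (.ofAdd x) := by
  simp [TorusPoint.eval]

variable (b : P.Base) (q : ParameterFunction P I) (a : TorusPoint X I)

/-- The ring homomorphism `ℋ^aff → ℋ^aff_{χ_a}`. -/
def heckeToSpec : AffineHecke b q →+* SpecHecke b q a :=
  (specMk b q a : _ →+* SpecHecke b q a).comp
    (Algebra.TensorProduct.includeRight (R := ℤ) (A := ℂ) (B := AffineHecke b q)).toRingHom

lemma heckeToSpec_apply (h : AffineHecke b q) :
    heckeToSpec b q a h = specMk b q a (1 ⊗ₜ[ℤ] h) := rfl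

/-- The image of `T_w` in the specialized algebra. -/
def specT (w : P.weylGroup) : SpecHecke b q a := heckeToSpec b q a (heckeT b q w)

/-- The image of `e^x` in the specialized algebra, as a monoid homomorphism. -/
def specE : Multiplicative X →* SpecHecke b q a where
  toFun x := heckeToSpec b q a (heckeE b q x.toAdd)
  map_one' := by
    rw [toAdd_one, heckeE, heckeMk_rel HeckeRel.E_zero, map_one, map_one]
  map_mul' x y := by
    rw [toAdd_mul, ← map_mul, heckeE, heckeE, heckeE, ← map_mul, heckeMk_rel (HeckeRel.E_add _ _)]

lemma specE_apply (x : Multiplicative X) :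
    specE b q a x = heckeToSpec b q a (heckeE b q x.toAdd) := rfl

lemma heckeToSpec_latToHecke_of_isWeylInvariant {z : LatticeAlgebra I X} (hz : IsWeylInvariant P z) :
    heckeToSpec b q a (latToHecke b q z) = algebraMap ℂ _ (a.eval z) := by
  rw [heckeToSpec_apply, ← (specMk b q a).commutes]
  exact RingQuot.mkAlgHom_rel ℂ ⟨z, hz, rfl, rfl⟩

/-- The parameters need no separate relation: the element `c e^0` is Weyl invariant, so the central
relations already specialize `c`. -/
lemma heckeToSpec_algebraMap (c : LaurentRing I) :
    heckeToSpec b q a (algebraMap _ _ c) = algebraMap ℂ _ (evalParam a.t c) := by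
  have hz : IsWeylInvariant P (AddMonoidAlgebra.single (0 : X) c) := fun w => by
    simp
  have h := heckeToSpec_latToHecke_of_isWeylInvariant b q a hz
  rw [eval_single, ofAdd_zero, map_one, Units.val_one, mul_one] at h
  rw [← h, ← (latToHecke b q).commutes]
  rfl

lemma heckeToSpec_smul (c : LaurentRing I) (h : AffineHecke b q) :
    heckeToSpec b q a (c • h) = evalParam a.t c • heckeToSpec b q a h := by
  rw [Algebra.smul_def, map_mul, heckeToSpec_algebraMap, Algebra.smul_def]

lemma heckeToSpec_latToHecke (z : LatticeAlgebra I X) :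
    heckeToSpec b q a (latToHecke b q z) = latEval a.t (specE b q a) z := by
  have : (heckeToSpec b q a).comp (latToHecke b q : _ →+* _) = latEval a.t (specE b q a) := by
    apply AddMonoidAlgebra.ringHom_ext
    · intro c
      rw [latEval_single, ofAdd_zero, map_one, ← Algebra.algebraMap_eq_smul_one,
        ← heckeToSpec_algebraMap, ← (latToHecke b q).commutes]
      rfl
    · intro x
      rw [latEval_single, map_one, one_smul]
      exact congrArg (heckeToSpec b q a) (latToHecke_latExp b q x)
  exact RingHom.congr_fun this z

lemma latEval_specE_of_isWeylInvariant {z : LatticeAlgebra I X} (hz : IsWeylInvariant P z) :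
    latEval a.t (specE b q a) z = algebraMap ℂ _ (a.eval z) := by
  rw [← heckeToSpec_latToHecke, heckeToSpec_latToHecke_of_isWeylInvariant b q a hz]

lemma specT_one : specT b q a 1 = 1 := by
  rw [specT, heckeT, heckeMk_rel HeckeRel.T_one, map_one, map_one]

lemma specT_mul {w w' : P.weylGroup}
    (h : weylLength b (w * w') = weylLength b w + weylLength b w') :
    specT b q a w * specT b q a w' = specT b q a (w * w') := by
  rw [specT, specT, specT, ← map_mul, heckeT, heckeT, heckeT, ← map_mul,
    heckeMk_rel (HeckeRel.T_mul _ _ h)]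

lemma specT_quadratic {i : ι} (hi : i ∈ b.support) :
    specT b q a (RootPairing.weylGroup.ofIdx P i) * specT b q a (RootPairing.weylGroup.ofIdx P i) =
      ((a.t (q.toFun i) : ℂ) - 1) • specT b q a (RootPairing.weylGroup.ofIdx P i) +
        algebraMap ℂ _ (a.t (q.toFun i) : ℂ) := by
  rw [specT, ← map_mul, heckeT, ← map_mul, heckeMk_rel (HeckeRel.quadratic i hi), map_add,
    map_add, map_smul, heckeToSpec_smul, AlgHom.commutes, heckeToSpec_algebraMap, map_sub,
    map_one, evalParam_qVar]

lemma specE_bernstein {i : ι} (hi : i ∈ b.support) (x : X) :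
    specE b q a (.ofAdd x) * specT b q a (RootPairing.weylGroup.ofIdx P i) -
      specT b q a (RootPairing.weylGroup.ofIdx P i) * specE b q a (.ofAdd (P.reflection i x)) =
      ((a.t (q.toFun i) : ℂ) - 1) • latEval a.t (specE b q a) (bernsteinQuotient P I i x) := by
  have h := congrArg (heckeToSpec b q a) (heckeMk_rel (HeckeRel.bernstein (q := q) i hi x))
  rw [map_smul, heckeToSpec_smul, heckeMk_freeLin, heckeToSpec_latToHecke, map_sub, map_sub,
    map_sub, map_one, evalParam_qVar, map_mul, map_mul, map_mul, map_mul] at h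
  exact h

variable {b q a} in
/-- The elements `T_w` and `e^x` generate the specialized algebra. -/
lemma specHecke_subalgebra_eq_top {S : Subalgebra ℂ (SpecHecke b q a)}
    (hT : ∀ w, specT b q a w ∈ S) (hE : ∀ x, specE b q a x ∈ S) : S = ⊤ := by
  rw [eq_top_iff]
  rintro s -
  obtain ⟨u, rfl⟩ := RingQuot.mkAlgHom_surjective ℂ (CentralRel b q a) s
  change specMk b q a u ∈ S
  induction u using TensorProduct.induction_on with
  | zero => rw [map_zero]; exact S.zero_mem
  | add u v hu hv => rw [map_add]; exact S.add_mem hu hv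
  | tmul c h =>
    have h1 : c ⊗ₜ[ℤ] h = c • ((1 : ℂ) ⊗ₜ[ℤ] h) := by
      rw [TensorProduct.smul_tmul', smul_eq_mul, mul_one]
    rw [h1, map_smul]
    clear h1
    refine S.smul_mem ?_ c
    rw [← heckeToSpec_apply]
    obtain ⟨y, rfl⟩ := RingQuot.mkAlgHom_surjective (LaurentRing I) (HeckeRel b q) h
    change heckeToSpec b q a (heckeMk b q y) ∈ S
    induction y using FreeAlgebra.induction with
    | grade0 r =>
      rw [AlgHom.commutes, heckeToSpec_algebraMap]
      exact S.algebraMap_mem _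
    | grade1 x =>
      rcases x with w | x
      · exact hT w
      · exact hE (.ofAdd x)
    | add x y hx hy => rw [map_add, map_add]; exact S.add_mem hx hy
    | mul x y hx hy => rw [map_mul, map_mul]; exact S.mul_mem hx hy

/-- The universal property of the specialized affine Hecke algebra. -/
lemma exists_specHecke_lift (τ : P.weylGroup → B) (θ : Multiplicative X →* B) (one : τ 1 = 1)
    (quadratic : ∀ i ∈ b.support,
      τ (RootPairing.weylGroup.ofIdx P i) * τ (RootPairing.weylGroup.ofIdx P i) =
        ((a.t (q.toFun i) : ℂ) - 1) • τ (RootPairing.weylGroup.ofIdx P i) +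
          algebraMap ℂ _ (a.t (q.toFun i) : ℂ))
    (mul : ∀ w w', weylLength b (w * w') = weylLength b w + weylLength b w' →
      τ w * τ w' = τ (w * w'))
    (bernstein : ∀ i ∈ b.support, ∀ x : X, θ (.ofAdd x) * τ (RootPairing.weylGroup.ofIdx P i) -
      τ (RootPairing.weylGroup.ofIdx P i) * θ (.ofAdd (P.reflection i x)) =
      ((a.t (q.toFun i) : ℂ) - 1) • latEval a.t θ (bernsteinQuotient P I i x))
    (central : ∀ z, IsWeylInvariant P z → latEval a.t θ z = algebraMap ℂ B (a.eval z)) :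
    ∃ F : SpecHecke b q a →ₐ[ℂ] B, (∀ w, F (specT b q a w) = τ w) ∧
      ∀ x, F (specE b q a x) = θ x := by
  let : Algebra (LaurentRing I) B :=
    ((algebraMap ℂ B).comp (evalParam a.t)).toAlgebra' fun _ _ => Algebra.commutes _ _
  have hmap : ∀ c : LaurentRing I, algebraMap (LaurentRing I) B c =
    algebraMap ℂ B (evalParam a.t c) := fun c => rfl
  have hsmul : ∀ (c : LaurentRing I) (y : B), c • y = evalParam a.t c • y := fun c y => by
    rw [Algebra.smul_def, Algebra.smul_def, hmap]
  let F0 : FreeHecke P I →ₐ[LaurentRing I] B :=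
    FreeAlgebra.lift _ (Sum.elim τ fun x => θ (.ofAdd x))
  have hT : ∀ w, F0 (freeT I w) = τ w := fun w => by simp [F0, freeT]
  have hE : ∀ x, F0 (freeE P I x) = θ (.ofAdd x) := fun w => by simp [F0, freeE]
  have hL : ∀ z, F0 (freeLin P I z) = latEval a.t θ z := by
    intro z
    rw [freeLin, Finsupp.sum, map_sum]
    conv_rhs => rw [← AddMonoidAlgebra.sum_coeff_single z, Finsupp.sum, map_sum]
    refine Finset.sum_congr rfl fun x _ => ?_
    rw [map_smul, hE, latEval_single, hsmul]
  let F1 : AffineHecke b q →ₐ[LaurentRing I] B := RingQuot.liftAlgHom _ ⟨F0, by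
    intro x y h
    cases h with
    | T_one => rw [hT, one, map_one]
    | E_zero => rw [hE, ofAdd_zero, map_one, map_one]
    | quadratic i hi =>
      rw [map_mul, map_add, map_smul, AlgHom.commutes, hT, quadratic i hi, hsmul, hmap, map_sub,
        map_one, evalParam_qVar]
    | T_mul w w' h => rw [map_mul, hT, hT, hT, mul w w' h]
    | E_add x y => rw [map_mul, hE, hE, hE, ofAdd_add, map_mul]
    | bernstein i hi x =>
      rw [map_sub, map_mul, map_mul, map_smul, hT, hE, hE, hL, bernstein i hi x, hsmul, map_sub,
        map_one, evalParam_qVar]⟩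
  have hF1 : ∀ y, F1 (heckeMk b q y) = F0 y := fun y => RingQuot.liftAlgHom_mkAlgHom_apply _ _ _ _
  have hF1L : ∀ z, F1 (latToHecke b q z) = latEval a.t θ z := fun z => by
    rw [← heckeMk_freeLin, hF1, hL]
  let F2 : ℂ ⊗[ℤ] AffineHecke b q →ₐ[ℂ] B :=
    Algebra.TensorProduct.lift (Algebra.ofId ℂ B) (F1 : _ →+* B).toIntAlgHom
      fun c y => Algebra.commutes c _
  have hF2 : ∀ h, F2 (1 ⊗ₜ h) = F1 h := fun h => by
    refine (Algebra.TensorProduct.lift_tmul _ _ _ _ _).trans ?_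
    rw [map_one, one_mul]
    rfl
  let F3 : SpecHecke b q a →ₐ[ℂ] B := RingQuot.liftAlgHom ℂ ⟨F2, by
    rintro u v ⟨z, hz, rfl, rfl⟩
    rw [hF2, hF1L, central z hz, AlgHom.commutes]⟩
  have hF3 : ∀ h, F3 (heckeToSpec b q a h) = F1 h := fun h => by
    rw [← hF2]
    exact RingQuot.liftAlgHom_mkAlgHom_apply ℂ F2 _ _
  exact ⟨F3, fun w => by rw [specT, hF3, heckeT, hF1, hT],
    fun x => by rw [specE_apply, hF3, heckeE, hF1, hE, ofAdd_toAdd]⟩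

section Positivity

open Polynomial
open scoped ComplexOrder

lemma TorusPoint.IsPositiveReal.pos {a : TorusPoint X I} (ha : a.IsPositiveReal)
    (x : Multiplicative X) : 0 < (a.s x : ℂ) := by
  obtain ⟨r, hr, h⟩ := ha.1 x.toAdd
  rw [ofAdd_toAdd] at h
  rw [h]
  exact_mod_cast hr

/-- The polynomial `∏_w (X - s(w x))` annihilates `e^x`. -/
lemma aeval_specE_prod [Fintype P.weylGroup] (x : X) :
    aeval (specE b q a (.ofAdd x))
      (∏ w : P.weylGroup, (Polynomial.X - C (a.s (.ofAdd (w • x)) : ℂ))) = 0 := by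
  let Q : (LatticeAlgebra I X)[X] :=
    ∏ w : P.weylGroup, (Polynomial.X - C (latExp I (w • x)))
  -- The Weyl group permutes the factors of `Q`. Its coefficients are therefore invariant and become
  -- scalars in the specialized algebra, while `e^x` is a root of `Q` from the factor `w = 1`.
  have hQ : ∀ n, IsWeylInvariant P (Q.coeff n) := by
    intro n w
    let σ : LatticeAlgebra I X →+* LatticeAlgebra I X :=
      AddMonoidAlgebra.mapDomainRingHom _ (DistribSMul.toAddMonoidHom X w)
    have hσ : ∀ y : X, σ (latExp I y) = latExp I (w • y) := fun y => by simp [σ, latExp]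
    have h : Q.map σ = Q := by
      simp only [Q, Polynomial.map_prod, Polynomial.map_sub, map_X, map_C, hσ]
      exact Fintype.prod_equiv (Equiv.mulLeft w) _ _ fun v => by simp [mul_smul]
    calc _ = σ (Q.coeff n) := rfl
      _ = (Q.map σ).coeff n := (coeff_map σ n).symm
      _ = _ := by rw [h]
  have h0 : Q.eval (latExp I x) = 0 := by
    rw [eval_prod]
    exact Finset.prod_eq_zero (Finset.mem_univ 1) (by simp)
  have hmap : (∏ w : P.weylGroup, (Polynomial.X - C (a.s (.ofAdd (w • x)) : ℂ))) = Q.map a.eval := by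
    simp only [Q, Polynomial.map_prod, Polynomial.map_sub, map_X, map_C, latExp, eval_single,
      map_one, one_mul]
  rw [hmap, aeval_def, eval₂_map, eval₂_eq_sum, Polynomial.sum]
  have h1 := congrArg (latEval a.t (specE b q a)) h0
  rw [map_zero, eval_eq_sum, Polynomial.sum, map_sum] at h1
  rw [← h1]
  refine Finset.sum_congr rfl fun n _ => ?_
  rw [map_mul, map_pow, latEval_latExp, latEval_specE_of_isWeylInvariant b q a (hQ n)]
  rfl

lemma isSpecPos_specE [Finite ι] {a : TorusPoint X I} (ha : a.IsPositiveReal)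
    (x : Multiplicative X) : IsSpecPos (specE b q a x) := by
  have := finite_weylGroup P
  have := Fintype.ofFinite P.weylGroup
  refine ⟨_, Finset.prod_ne_zero_iff.2 fun w _ => X_sub_C_ne_zero _, fun z hz => ?_,
    aeval_specE_prod b q a x.toAdd⟩
  rw [IsRoot.def, eval_prod, Finset.prod_eq_zero_iff] at hz
  obtain ⟨w, -, hz⟩ := hz
  rw [eval_sub, eval_X, eval_C, sub_eq_zero] at hz
  rw [hz]
  exact ha.pos _

end Positivity

end Specialization

/-! ### Extending the lattice part of the smaller algebra by positive roots. -/

section RootExtension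

variable {ι X Y I : Type*} [AddCommGroup X] [AddCommGroup Y]
variable {ι' X' Y' : Type*} [AddCommGroup X'] [AddCommGroup Y']
variable {P' : RootDatum ι' X' Y'} {P : RootDatum ι X Y} {b' : P'.Base} {b : P.Base}
variable {f : RootPairing.Hom P' P}

lemma IsCentralIsogeny.exists_nsmul (hf : IsCentralIsogeny b' b f) :
    ∃ N : ℕ, N ≠ 0 ∧ ∀ x : X, ∃ y : X', f.weightMap y = N • x := by
  have := hf.finite_coker
  refine ⟨Nat.card (X ⧸ LinearMap.range f.weightMap), Nat.card_pos.ne', fun x => ?_⟩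
  have hn : Nat.card (X ⧸ LinearMap.range f.weightMap) • x ∈ LinearMap.range f.weightMap := by
    rw [← Submodule.Quotient.mk_eq_zero, Submodule.Quotient.mk_smul]
    exact card_nsmul_eq_zero'
  exact hn

lemma TorusPoint.IsPositiveReal.map {a : TorusPoint X I} (ha : a.IsPositiveReal)
    (f : RootPairing.Hom P' P) : (a.map f).IsPositiveReal :=
  ⟨fun x => ha.1 (f.weightMap x), ha.2⟩

lemma commute_of_mem_adjoin_range {R A M : Type*} [CommSemiring R] [Semiring A] [Algebra R A]
    [CommMonoid M] (e : M →* A) {x y : A} (hx : x ∈ Algebra.adjoin R (Set.range e))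
    (hy : y ∈ Algebra.adjoin R (Set.range e)) : Commute x y := by
  refine Algebra.commute_of_mem_adjoin_of_forall_mem_commute hy ?_
  rintro _ ⟨m, rfl⟩
  refine (Algebra.commute_of_mem_adjoin_of_forall_mem_commute hx ?_).symm
  rintro _ ⟨n, rfl⟩
  rw [Commute, SemiconjBy, ← map_mul, ← map_mul, mul_comm]

variable (q : ParameterFunction P I) (hf : IsCentralIsogeny b' b f)
  {a : TorusPoint X I}

/-- The elements `e^{x'}` extend to a multiplicative family of spectrally positive elements
indexed by the larger lattice. -/
lemma exists_root_extension [Finite ι'] (ha : a.IsPositiveReal) :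
    ∃ θ : Multiplicative X →* SpecHecke b' (q.pullback hf) (a.map f),
      (∀ x, IsSpecPos (θ x)) ∧
      (∀ x, θ x ∈ Algebra.adjoin ℂ (Set.range (specE b' (q.pullback hf) (a.map f)))) ∧
      ∀ x, θ (.ofAdd (f.weightMap x)) = specE b' (q.pullback hf) (a.map f) (.ofAdd x) := by
  obtain ⟨N, hN, h⟩ := hf.exists_nsmul
  choose g hg using h
  set e := specE b' (q.pullback hf) (a.map f)
  have hpos : ∀ x, IsSpecPos (e x) := isSpecPos_specE _ _ (ha.map f)
  have hroot : ∀ x : X, ∃ r ∈ Algebra.adjoin ℂ (Set.range e), IsSpecPos r ∧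
      r ^ N = e (.ofAdd (g x)) := fun x => by
    obtain ⟨r, hr, h⟩ := (hpos (.ofAdd (g x))).exists_pow_eq hN
    exact ⟨r, Algebra.adjoin_mono (Set.singleton_subset_iff.2 (Set.mem_range_self _)) hr, h⟩
  choose θ hθ hθpos hθN using hroot
  have hmem : ∀ y, e y ∈ Algebra.adjoin ℂ (Set.range e) := fun y =>
    Algebra.subset_adjoin ⟨y, rfl⟩
  -- This and multiplicativity both follow from uniqueness of positive roots, which applies because
  -- everything lies in the commutative subalgebra generated by the `e^{x'}`.
  have hextend : ∀ y, θ (f.weightMap y) = e (.ofAdd y) := fun y => by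
    refine (hθpos _).eq_of_pow_eq (hpos _) (commute_of_mem_adjoin_range e (hθ _) (hmem _)) hN ?_
    rw [hθN, ← map_pow, ← ofAdd_nsmul]
    congr 2
    exact hf.injective (by rw [hg, map_nsmul])
  refine ⟨{ toFun := fun x => θ x.toAdd, map_one' := ?_, map_mul' := fun x y => ?_ },
    fun x => hθpos _, fun x => hθ _, hextend⟩
  · have := hextend 0
    rwa [map_zero, ofAdd_zero, map_one] at this
  · refine (hθpos _).eq_mul_of_pow_eq (hθpos _) (hθpos _)
      (commute_of_mem_adjoin_range e (hθ _) (hθ _)) (commute_of_mem_adjoin_range e (hθ _) (hθ _))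
      (commute_of_mem_adjoin_range e (hθ _) (hθ _)) hN ?_
    rw [(commute_of_mem_adjoin_range e (hθ _) (hθ _)).mul_pow, hθN, hθN, hθN, ← map_mul, ← ofAdd_add]
    congr 2
    exact hf.injective (by rw [hg, map_add, hg, hg, toAdd_mul, nsmul_add])

variable {q hf}

lemma latEval_latMap {B : Type*} [Ring B] [Algebra ℂ B] {θ : Multiplicative X →* B}
    {e : Multiplicative X' →* B} (h : ∀ x, θ (.ofAdd (f.weightMap x)) = e (.ofAdd x))
    (t : I → ℂˣ) (z : LatticeAlgebra I X') : latEval t θ (latMap I f z) = latEval t e z := by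
  have : (latEval t θ).comp (latMap I f : LatticeAlgebra I X' →+* LatticeAlgebra I X) =
      latEval t e := by
    apply AddMonoidAlgebra.ringHom_ext
    · intro c
      simp [latMap, latEval_single]
    · intro x
      simp [latMap, latEval_single, h]
  exact RingHom.congr_fun this z

/-- The Bernstein relation holds for the extended family. -/
lemma bernstein_root_extension [Module.Finite ℤ X]
    {θ : Multiplicative X →* SpecHecke b' (q.pullback hf) (a.map f)}
    (hpos : ∀ x, IsSpecPos (θ x))
    (hθ : ∀ x, θ (.ofAdd (f.weightMap x)) = specE b' (q.pullback hf) (a.map f) (.ofAdd x))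
    {i : ι'} (hi : i ∈ b'.support) (x : X) :
    θ (.ofAdd x) * specT b' (q.pullback hf) (a.map f) (RootPairing.weylGroup.ofIdx P' i) -
      specT b' (q.pullback hf) (a.map f) (RootPairing.weylGroup.ofIdx P' i) *
        θ (.ofAdd (P.reflection (f.indexEquiv i) x)) =
      ((a.t (q.toFun (f.indexEquiv i)) : ℂ) - 1) •
        latEval a.t θ (bernsteinQuotient P I (f.indexEquiv i) x) := by
  obtain ⟨N, hN, h⟩ := hf.exists_nsmul
  set T := specT b' (q.pullback hf) (a.map f) (RootPairing.weylGroup.ofIdx P' i)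
  set j := f.indexEquiv i
  set c : ℂ := (a.t (q.toFun j) : ℂ) - 1
  -- `D` measures the failure of the Bernstein relation; it vanishes on `f(X')`, where the relation
  -- is that of the smaller algebra.
  set D : X → SpecHecke b' (q.pullback hf) (a.map f) := fun x =>
    θ (.ofAdd x) * T - T * θ (.ofAdd (P.reflection j x)) -
      c • latEval a.t θ (bernsteinQuotient P I j x) with hD
  have hDadd : ∀ x y, D (x + y) =
      θ (.ofAdd x) * D y + D x * θ (.ofAdd (P.reflection j y)) := by
    intro x y
    simp only [hD, map_add, ofAdd_add, map_mul, bernsteinQuotient_add, latEval_latExp, mul_sub,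
      sub_mul, smul_add, mul_smul_comm, smul_mul_assoc, mul_assoc]
    abel
  have hD0 : D 0 = 0 := by simp [hD, bernsteinQuotient_zero]
  have hDf : ∀ y, D (f.weightMap y) = 0 := by
    intro y
    simp only [hD]
    rw [sub_eq_zero, ← latMap_bernsteinQuotient, latEval_latMap hθ, ← weightMap_reflection, hθ, hθ]
    exact specE_bernstein b' (q.pullback hf) (a.map f) hi y
  -- Iterating the twisted derivation rule expresses `D (n • x)` through `D x`. For `n = N` the left
  -- side is zero, and the resulting Sylvester equation forces `D x = 0`.
  have hDn : ∀ n : ℕ, D (n • x) = ∑ k ∈ Finset.range n,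
      θ (.ofAdd x) ^ k * D x * θ (.ofAdd (P.reflection j x)) ^ (n - 1 - k) := by
    intro n
    induction n with
    | zero => simpa using hD0
    | succ n ih =>
      rw [succ_nsmul', hDadd, ih, Finset.sum_range_succ', Finset.mul_sum, map_nsmul, ofAdd_nsmul,
        map_pow]
      congr 1
      · refine Finset.sum_congr rfl fun k _ => ?_
        rw [← mul_assoc, ← mul_assoc, ← pow_succ']
        congr 2
        omega
      · simp
  obtain ⟨y, hy⟩ := h x
  have h0 := hDn N
  rw [← hy, hDf] at h0
  exact sub_eq_zero.1 ((hpos _).eq_zero_of_sum_eq_zero (hpos _) hN h0.symm)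

lemma specHeckeMap_specT (w : P'.weylGroup) :
    specHeckeMap q hf a (specT b' (q.pullback hf) (a.map f) w) = specT b q a (hf.weylMap w) := by
  rw [specT, heckeToSpec_apply, specHeckeMap_specMk, specT, heckeToSpec_apply, ← heckeMap_T]
  rfl

lemma specHeckeMap_specE (x : X') :
    specHeckeMap q hf a (specE b' (q.pullback hf) (a.map f) (.ofAdd x)) =
      specE b q a (.ofAdd (f.weightMap x)) := by
  rw [specE_apply, heckeToSpec_apply, specHeckeMap_specMk, specE_apply, heckeToSpec_apply,
    toAdd_ofAdd, toAdd_ofAdd, ← heckeMap_E]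
  rfl

/-- The canonical map between specialized affine Hecke algebras is surjective at positive real
points. -/
lemma specHeckeMap_surjective [Finite ι] [Finite ι'] (ha : a.IsPositiveReal) :
    Function.Surjective (specHeckeMap q hf a) := by
  rw [← AlgHom.range_eq_top]
  refine specHecke_subalgebra_eq_top (fun w => ?_) fun x => ?_
  · obtain ⟨w, rfl⟩ := hf.weylMap_surjective w
    exact ⟨_, specHeckeMap_specT w⟩
  · obtain ⟨θ, hpos, hmem, hθ⟩ := exists_root_extension q hf ha
    obtain ⟨N, hN, h⟩ := hf.exists_nsmul
    refine ⟨θ x, ?_⟩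
    have hadj : specHeckeMap q hf a (θ x) ∈ Algebra.adjoin ℂ (Set.range (specE b q a)) := by
      have h1 := Subalgebra.mem_map.2 ⟨_, hmem x, (rfl : specHeckeMap q hf a (θ x) = _)⟩
      rw [AlgHom.map_adjoin] at h1
      refine Algebra.adjoin_mono ?_ h1
      rintro _ ⟨_, ⟨y, rfl⟩, rfl⟩
      exact ⟨_, (specHeckeMap_specE y.toAdd).symm⟩
    obtain ⟨y, hy⟩ := h x.toAdd
    -- The image of `θ x` and `e^x` are commuting spectrally positive elements with the same `N`-th
    -- power.
    refine ((hpos x).map _).eq_of_pow_eq (isSpecPos_specE b q ha x)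
      (commute_of_mem_adjoin_range _ hadj (Algebra.subset_adjoin ⟨x, rfl⟩)) hN ?_
    have hx : x ^ N = .ofAdd (f.weightMap y) := by rw [hy, ofAdd_nsmul, ofAdd_toAdd]
    change specHeckeMap q hf a (θ x) ^ N = _
    rw [← map_pow, ← map_pow, ← map_pow, hx, hθ, specHeckeMap_specE]

/-- With `σ` the reflection on `𝒜[X]`, the additive map `D z = z T - T σ(z)` is given on each `e^x`
by the Bernstein quotient, which changes sign under `σ`. Thus `2 D z = 0` when `σ z = z`. -/
lemma latEval_commute_of_bernstein {B : Type*} [Ring B] [Algebra ℂ B] {θ : Multiplicative X →* B}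
    {t : I → ℂˣ} {i : ι} {T : B} {c : ℂ}
    (h : ∀ x, θ (.ofAdd x) * T - T * θ (.ofAdd (P.reflection i x)) =
      c • latEval t θ (bernsteinQuotient P I i x)) {z : LatticeAlgebra I X}
    (hz : IsWeylInvariant P z) : Commute (latEval t θ z) T := by
  let σ : LatticeAlgebra I X →+ LatticeAlgebra I X :=
    (AddMonoidAlgebra.mapDomainRingHom (LaurentRing I)
      (DistribSMul.toAddMonoidHom X (RootPairing.weylGroup.ofIdx P i))).toAddMonoidHom
  have hσs : ∀ x (r : LaurentRing I), σ (AddMonoidAlgebra.single x r) =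
      AddMonoidAlgebra.single (P.reflection i x) r := fun x r => by
    simp [σ]
  have hσ : σ z = z := hz _
  let D : LatticeAlgebra I X →+ B :=
    (AddMonoidHom.mulRight T).comp (latEval t θ).toAddMonoidHom -
      (AddMonoidHom.mulLeft T).comp ((latEval t θ).toAddMonoidHom.comp σ)
  have hDs : ∀ x (r : LaurentRing I), D (AddMonoidAlgebra.single x r) =
      evalParam t r • c • latEval t θ (bernsteinQuotient P I i x) := fun x r => by
    rw [← h]
    simp [D, hσs, latEval_single, smul_sub]
  have hDσ : D.comp σ = -D := by
    apply AddMonoidAlgebra.addMonoidHom_ext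
    intro x r
    rw [AddMonoidHom.comp_apply, hσs, hDs, bernsteinQuotient_reflection, AddMonoidHom.neg_apply,
      hDs, map_neg, smul_neg, smul_neg]
  have h1 := DFunLike.congr_fun hDσ z
  rw [AddMonoidHom.comp_apply, hσ, AddMonoidHom.neg_apply, eq_neg_iff_add_eq_zero, ← two_smul ℂ,
    smul_eq_zero_iff_right two_ne_zero] at h1
  have h2 : D z = latEval t θ z * T - T * latEval t θ (σ z) := rfl
  rw [hσ, h1] at h2
  exact (sub_eq_zero.1 h2.symm)

/-- Weyl group invariants of the extended family are central. -/
lemma latEval_root_extension_commute [Finite ι'] [Module.Finite ℤ X]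
    {θ : Multiplicative X →* SpecHecke b' (q.pullback hf) (a.map f)}
    (hpos : ∀ x, IsSpecPos (θ x))
    (hθ : ∀ x, θ (.ofAdd (f.weightMap x)) = specE b' (q.pullback hf) (a.map f) (.ofAdd x))
    {z : LatticeAlgebra I X} (hz : IsWeylInvariant P z)
    (s : SpecHecke b' (q.pullback hf) (a.map f)) : Commute (latEval a.t θ z) s := by
  -- The Bernstein relation handles only simple reflections; reduced words give the other `T_w`.
  have key : Subalgebra.centralizer ℂ {latEval a.t θ z} = ⊤ := by
    refine specHecke_subalgebra_eq_top (fun w => ?_) fun x => ?_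
    · rw [Subalgebra.mem_centralizer_iff]
      rintro _ rfl
      change Commute _ _
      refine weyl_length_induction b'
        (p := fun w => Commute (latEval a.t θ z) (specT b' (q.pullback hf) (a.map f) w))
        ?_ (fun i hi w hw ih => ?_) w
      · rw [specT_one]
        exact .one_right _
      · rw [← specT_mul _ _ _ hw]
        exact (latEval_commute_of_bernstein (bernstein_root_extension hpos hθ hi) hz).mul_right ih
    · rw [Subalgebra.mem_centralizer_iff]
      rintro _ rfl
      rw [← ofAdd_toAdd x, ← hθ, ← latEval_latExp a.t θ, ← map_mul, ← map_mul, mul_comm]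
  have hs : s ∈ Subalgebra.centralizer ℂ {latEval a.t θ z} := by rw [key]; trivial
  exact Subalgebra.mem_centralizer_iff ℂ |>.1 hs _ rfl

end RootExtension

/-! ### Rigidity of positive characters. -/

section PositiveCharacters

open scoped ComplexOrder

lemma pow_left_injective_of_pos {x y : ℂ} (hx : 0 < x) (hy : 0 < y) {n : ℕ} (hn : n ≠ 0)
    (h : x ^ n = y ^ n) : x = y := by
  obtain ⟨r, hr, rfl⟩ := exists_real_of_pos hx
  obtain ⟨s, hs, rfl⟩ := exists_real_of_pos hy
  norm_cast at h ⊢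
  exact (pow_left_inj₀ hr.le hs.le hn).1 h

/-- A positive character that agrees pointwise with one of finitely many positive characters
equals one of them. -/
lemma exists_eq_of_forall_exists_eq {G κ : Type*} [CommGroup G] [Finite κ] {σ : G →* ℂˣ}
    (hσ : ∀ x, 0 < (σ x : ℂ)) {s : κ → G →* ℂˣ} (hs : ∀ k x, 0 < (s k x : ℂ))
    (h : ∀ x, ∃ k, σ x = s k x) : ∃ k, σ = s k := by
  have := Fintype.ofFinite κ
  -- The subgroups where `σ` agrees with some `s k` cover `G`, so by B. H. Neumann's lemma one has
  -- finite index. There `σ` and `s k` agree after raising to that index, hence agree by positivity.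
  obtain ⟨k, -, hk⟩ := Subgroup.exists_finiteIndex_of_leftCoset_cover (G := G)
    (s := (Finset.univ : Finset κ)) (H := fun k => σ.eqLocus (s k)) (g := fun _ => 1) (by
      rw [Set.eq_univ_iff_forall]
      intro x
      obtain ⟨k, hk⟩ := h x
      simp only [Set.mem_iUnion]
      exact ⟨k, Finset.mem_univ k, x, hk, one_smul _ _⟩)
  refine ⟨k, MonoidHom.ext fun x => Units.ext ?_⟩
  have h1 : x ^ (σ.eqLocus (s k)).index ∈ σ.eqLocus (s k) := Subgroup.pow_index_mem _ x
  have h2 : σ (x ^ (σ.eqLocus (s k)).index) = s k (x ^ (σ.eqLocus (s k)).index) := h1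
  rw [map_pow, map_pow] at h2
  refine pow_left_injective_of_pos (hσ x) (hs k x) hk.index_ne_zero ?_
  exact_mod_cast congrArg Units.val h2

end PositiveCharacters

/-! ### Central characters and extension of simple modules. -/

section CentralCharacter

open scoped ComplexOrder

variable {ι X Y I : Type*} [AddCommGroup X] [AddCommGroup Y]
variable {ι' X' Y' : Type*} [AddCommGroup X'] [AddCommGroup Y']
variable {P' : RootDatum ι' X' Y'} {P : RootDatum ι X Y} {b' : P'.Base} {b : P.Base}
variable {f : RootPairing.Hom P' P} {q : ParameterFunction P I} {hf : IsCentralIsogeny b' b f}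
  {a : TorusPoint X I}

/-- A commuting multiplicative family of spectrally positive operators indexed by a finitely
generated abelian group has a joint eigenvector. -/
lemma exists_weight_vector {V : Type*} [AddCommGroup V] [Module ℂ V] [Nontrivial V]
    [Module.Finite ℤ X] (θ : Multiplicative X →* Module.End ℂ V) (hpos : ∀ x, IsSpecPos (θ x)) :
    ∃ v : V, v ≠ 0 ∧ ∃ σ : Multiplicative X →* ℂˣ, (∀ x, 0 < (σ x : ℂ)) ∧
      ∀ x, θ x v = (σ x : ℂ) • v := by
  obtain ⟨S, hS⟩ := (Module.finite_def.1 (inferInstance : Module.Finite ℤ X))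
  obtain ⟨v, -, hv0, hv⟩ := exists_joint_eigenvector (fun x : X => θ (.ofAdd x))
    (fun x => hpos _) (fun x y => (Commute.all (Multiplicative.ofAdd x) (.ofAdd y)).map θ)
    (K := ⊤) (fun _ _ _ => trivial) top_ne_bot S
  refine ⟨v, hv0, ?_⟩
  have hall : ∀ x : Multiplicative X, ∃ c : ℂˣ, 0 < (c : ℂ) ∧ θ x v = (c : ℂ) • v := by
    intro x
    have hx : x.toAdd ∈ Submodule.span ℤ (S : Set X) := by rw [hS]; trivial
    rw [← ofAdd_toAdd x]
    generalize x.toAdd = x at hx ⊢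
    induction hx using Submodule.span_induction with
    | mem y hy =>
      obtain ⟨c, hc, h⟩ := hv y hy
      exact ⟨Units.mk0 c hc.ne', hc, h⟩
    | zero => exact ⟨1, one_pos, by simp⟩
    | add y z _ _ hy hz =>
      obtain ⟨c, hc, h⟩ := hy
      obtain ⟨d, hd, h'⟩ := hz
      refine ⟨c * d, by rw [Units.val_mul]; exact mul_pos hc hd, ?_⟩
      rw [ofAdd_add, map_mul, Module.End.mul_apply, h', map_smul, h, smul_smul, Units.val_mul, mul_comm]
    | smul n y _ hy =>
      obtain ⟨c, hc, h⟩ := hy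
      have hinv : θ (.ofAdd (-y)) v = ((c⁻¹ : ℂˣ) : ℂ) • v := by
        have h1 : θ (.ofAdd (-y)) (θ (.ofAdd y) v) = v := by
          rw [← Module.End.mul_apply, ← map_mul, ← ofAdd_add, neg_add_cancel, ofAdd_zero, map_one,
            Module.End.one_apply]
        rw [h, map_smul] at h1
        rw [← h1, smul_smul, Units.inv_mul, one_smul, h1]
      have hn : ∀ (y : X) (c : ℂˣ), 0 < (c : ℂ) → θ (.ofAdd y) v = (c : ℂ) • v → ∀ n : ℕ,
          ∃ d : ℂˣ, 0 < (d : ℂ) ∧ θ (.ofAdd (n • y)) v = (d : ℂ) • v := fun y c hc h n =>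
        ⟨c ^ n, by rw [Units.val_pow_eq_pow_val]; exact pow_pos hc n, by
          rw [ofAdd_nsmul, map_pow, pow_apply_eq_smul h, Units.val_pow_eq_pow_val]⟩
      obtain ⟨m, rfl | rfl⟩ := n.eq_nat_or_neg
      · simpa using hn y c hc h m
      · simpa using hn (-y) c⁻¹ (by simpa using inv_pos.2 hc) hinv m
  choose σ hσ h using hall
  have hinj : ∀ {c d : ℂˣ}, (c : ℂ) • v = (d : ℂ) • v → c = d := fun h =>
    Units.ext (smul_left_injective ℂ hv0 h)
  refine ⟨⟨⟨σ, hinj ?_⟩, fun x y => hinj ?_⟩, hσ, h⟩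
  · rw [← h, map_one, Module.End.one_apply, Units.val_one, one_smul]
  · rw [← h, map_mul, Module.End.mul_apply, h y, map_smul, h x, smul_smul, Units.val_mul, mul_comm]

/-- The restriction of `s` along the action of a Weyl group element. -/
def TorusPoint.weylTwist (a : TorusPoint X I) (w : P.weylGroup) : TorusPoint X I where
  s := a.s.comp (AddMonoidHom.toMultiplicative (DistribSMul.toAddMonoidHom X w))
  t := a.t

lemma eval_weylTwist (a : TorusPoint X I) (w : P.weylGroup) {z : LatticeAlgebra I X}
    (hz : IsWeylInvariant P z) : (a.weylTwist w).eval z = a.eval z := by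
  have : (a.weylTwist w).eval.toAddMonoidHom = a.eval.toAddMonoidHom.comp
      (AddMonoidAlgebra.mapDomainRingHom (LaurentRing I)
        (DistribSMul.toAddMonoidHom X w)).toAddMonoidHom := by
    apply AddMonoidAlgebra.addMonoidHom_ext
    intro x r
    simp [eval_single, TorusPoint.weylTwist]
  refine (DFunLike.congr_fun this z).trans ?_
  exact congrArg a.eval (hz w)

lemma latEval_apply_weight_vector {V : Type*} [AddCommGroup V] [Module ℂ V]
    {θ : Multiplicative X →* Module.End ℂ V} {v : V} {σ : Multiplicative X →* ℂˣ}
    (h : ∀ x, θ x v = (σ x : ℂ) • v) (t : I → ℂˣ) (z : LatticeAlgebra I X) :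
    latEval t θ z v = (⟨σ, t⟩ : TorusPoint X I).eval z • v := by
  have : (LinearMap.applyₗ (R := ℂ) v).toAddMonoidHom.comp (latEval t θ).toAddMonoidHom =
      (LinearMap.toSpanSingleton ℂ V v).toAddMonoidHom.comp
        (⟨σ, t⟩ : TorusPoint X I).eval.toAddMonoidHom := by
    apply AddMonoidAlgebra.addMonoidHom_ext
    intro x r
    simp [latEval_single, eval_single, h, smul_smul]
  exact DFunLike.congr_fun this z

variable [Finite ι] [Finite ι'] [Module.Finite ℤ X]

/-- On a module over the smaller algebra, the extended family has a weight vector on which the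
invariants act through the central character. -/
lemma exists_central_vector (ha : a.IsPositiveReal)
    {θ : Multiplicative X →* SpecHecke b' (q.pullback hf) (a.map f)}
    (hpos : ∀ x, IsSpecPos (θ x))
    (hθ : ∀ x, θ (.ofAdd (f.weightMap x)) = specE b' (q.pullback hf) (a.map f) (.ofAdd x))
    {V : Type*} [AddCommGroup V] [Module ℂ V] [Nontrivial V]
    (ρ : SpecHecke b' (q.pullback hf) (a.map f) →ₐ[ℂ] Module.End ℂ V) :
    ∃ v : V, v ≠ 0 ∧ ∀ z : LatticeAlgebra I X, IsWeylInvariant P z →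
      ρ (latEval a.t θ z) v = a.eval z • v := by
  have := finite_weylGroup P'
  have := finite_weylGroup P
  have := Fintype.ofFinite P'.weylGroup
  obtain ⟨v, hv0, σ, hσ, hv⟩ := exists_weight_vector ((ρ : _ →* Module.End ℂ V).comp θ)
    fun x => (hpos x).map ρ
  refine ⟨v, hv0, fun z hz => ?_⟩
  obtain ⟨N, hN, hdiv⟩ := hf.exists_nsmul
  -- If `f(y) = N x`, then `σ(x) ^ N` is an eigenvalue of `e^y`, so it equals `s(w x) ^ N` for some
  -- `w` depending on `x`. Positivity removes the exponent, and the covering argument makes `w`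
  -- uniform.
  obtain ⟨w, hw⟩ : ∃ w : P.weylGroup, σ = (a.weylTwist w).s := by
    refine exists_eq_of_forall_exists_eq hσ (fun w x => ha.pos _) fun x => ?_
    obtain ⟨y, hy⟩ := hdiv x.toAdd
    have h1 := congrArg ρ (aeval_specE_prod b' (q.pullback hf) (a.map f) y)
    rw [← Polynomial.aeval_algHom_apply, map_zero] at h1
    have hyv : ρ (specE b' (q.pullback hf) (a.map f) (.ofAdd y)) v = ((σ x : ℂ) ^ N) • v := by
      rw [← hθ, hy, ofAdd_nsmul, ofAdd_toAdd, ← Units.val_pow_eq_pow_val, ← map_pow]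
      exact hv _
    have h2 : ∀ p : Polynomial ℂ, Polynomial.aeval
        (ρ (specE b' (q.pullback hf) (a.map f) (.ofAdd y))) p v = p.eval ((σ x : ℂ) ^ N) • v :=
      fun p => Module.End.aeval_apply_of_hasEigenvector ⟨Module.End.mem_eigenspace_iff.2 hyv, hv0⟩
    have h3 := h2 (∏ w : P'.weylGroup,
      (Polynomial.X - Polynomial.C ((a.map f).s (.ofAdd (w • y)) : ℂ)))
    rw [h1, LinearMap.zero_apply, eq_comm, smul_eq_zero_iff_left hv0, Polynomial.eval_prod,
      Finset.prod_eq_zero_iff] at h3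
    obtain ⟨w, -, h3⟩ := h3
    rw [Polynomial.eval_sub, Polynomial.eval_X, Polynomial.eval_C, sub_eq_zero] at h3
    refine ⟨hf.weylMap w, Units.ext (pow_left_injective_of_pos (hσ x) (ha.pos _) hN ?_)⟩
    rw [h3]
    have h4 : (a.map f).s (.ofAdd (w • y)) = a.s (.ofAdd (f.weightMap (w • y))) := rfl
    rw [h4, hf.weightMap_smul, hy, weyl_smul_eq, map_nsmul, ofAdd_nsmul, map_pow, Units.val_pow_eq_pow_val]
    rfl
  have h5 := latEval_apply_weight_vector (θ := (ρ : _ →* Module.End ℂ V).comp θ) hv a.t z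
  rw [hw] at h5
  have h6 : latEval a.t ((ρ : _ →* Module.End ℂ V).comp θ) z = ρ (latEval a.t θ z) :=
    latEval_comp ρ θ a.t z
  rw [← h6, h5]
  congr 1
  exact eval_weylTwist a w hz

/-- The action of the smaller algebra on a simple module extends to the larger algebra. -/
lemma exists_extension (ha : a.IsPositiveReal) {V : Type*} [AddCommGroup V] [Module ℂ V]
    [Module (SpecHecke b' (q.pullback hf) (a.map f)) V]
    [IsScalarTower ℂ (SpecHecke b' (q.pullback hf) (a.map f)) V]
    [IsSimpleModule (SpecHecke b' (q.pullback hf) (a.map f)) V] :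
    ∃ F : SpecHecke b q a →ₐ[ℂ] Module.End ℂ V, ∀ (s) (v : V),
      F (specHeckeMap q hf a s) v = s • v := by
  have : Nontrivial V := IsSimpleModule.nontrivial (SpecHecke b' (q.pullback hf) (a.map f)) V
  obtain ⟨θ, hpos, hmem, hθ⟩ := exists_root_extension q hf ha
  let ρ : SpecHecke b' (q.pullback hf) (a.map f) →ₐ[ℂ] Module.End ℂ V := Algebra.lsmul ℂ ℂ V
  have hlat : ∀ z, latEval a.t ((ρ : _ →* Module.End ℂ V).comp θ) z = ρ (latEval a.t θ z) :=
    latEval_comp ρ θ a.t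
  let e : P'.weylGroup ≃* P.weylGroup :=
    MulEquiv.ofBijective hf.weylMap ⟨hf.weylMap_injective, hf.weylMap_surjective⟩
  have he : ∀ w, hf.weylMap (e.symm w) = w := e.apply_symm_apply
  have hes : ∀ i, e.symm (RootPairing.weylGroup.ofIdx P (f.indexEquiv i)) =
      RootPairing.weylGroup.ofIdx P' i := fun i => by
    rw [e.symm_apply_eq]
    exact (hf.weylMap_ofIdx i).symm
  have hsimple : ∀ i ∈ b.support, ∃ j ∈ b'.support, f.indexEquiv j = i := fun i hi => by
    refine ⟨f.indexEquiv.symm i, ?_, f.indexEquiv.apply_symm_apply i⟩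
    rwa [← hf.map_base, f.indexEquiv.apply_symm_apply]
  obtain ⟨F, hT, hE⟩ := exists_specHecke_lift b q a
    (fun w => ρ (specT b' (q.pullback hf) (a.map f) (e.symm w)))
    ((ρ : _ →* Module.End ℂ V).comp θ)
    (by simp only [map_one, specT_one])
    (by
      intro i hi
      obtain ⟨j, hj, rfl⟩ := hsimple i hi
      have h := congrArg ρ (specT_quadratic b' (q.pullback hf) (a.map f) hj)
      rw [map_mul, map_add, map_smul, AlgHom.commutes] at h
      simp only [hes]
      exact h)
    (by
      intro w w' h
      rw [← map_mul, specT_mul, map_mul e.symm]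
      rw [← hf.weylLength_weylMap, ← hf.weylLength_weylMap, ← hf.weylLength_weylMap, map_mul, he,
        he, h])
    (by
      intro i hi x
      obtain ⟨j, hj, rfl⟩ := hsimple i hi
      have h := congrArg ρ (bernstein_root_extension hpos hθ hj x)
      rw [map_sub, map_mul, map_mul, map_smul] at h
      rw [hlat, hes]
      exact h)
    (by
      intro z hz
      rw [hlat]
      obtain ⟨v, hv0, hv⟩ := exists_central_vector ha hpos hθ ρ
      -- A substitute for Schur's lemma that needs no finite-dimensionality: the eigenspace of a
      -- central element is a submodule, and it contains `v ≠ 0`.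
      let K : Submodule (SpecHecke b' (q.pullback hf) (a.map f)) V :=
        { carrier := {u | ρ (latEval a.t θ z) u = a.eval z • u}
          add_mem' := fun {u w} hu hw => by
            simp only [Set.mem_ofPred_eq] at hu hw ⊢
            rw [map_add, hu, hw, smul_add]
          zero_mem' := by simp
          smul_mem' := fun s u hu => by
            simp only [Set.mem_ofPred_eq] at hu ⊢
            have hs : s • u = ρ s u := rfl
            rw [hs, ← Module.End.mul_apply, ← map_mul,
              (latEval_root_extension_commute hpos hθ hz s).eq, map_mul, Module.End.mul_apply, hu,
              map_smul] }
      have hK : K = ⊤ := (eq_bot_or_eq_top K).resolve_left fun h =>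
        hv0 (by
          have : v ∈ K := hv z hz
          rwa [h, Submodule.mem_bot] at this)
      ext u
      have hu : u ∈ K := by rw [hK]; trivial
      rw [Module.algebraMap_end_apply]
      exact hu)
  refine ⟨F, fun s v => ?_⟩
  -- That `F` extends the given action need only be checked on the generators `T_w` and `e^x`.
  have key : AlgHom.equalizer (F.comp (specHeckeMap q hf a)) ρ = ⊤ := by
    refine specHecke_subalgebra_eq_top (fun w => ?_) fun x => ?_
    · rw [AlgHom.mem_equalizer, AlgHom.comp_apply, specHeckeMap_specT, hT]
      exact congrArg _ (congrArg _ (e.symm_apply_apply w))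
    · rw [AlgHom.mem_equalizer, AlgHom.comp_apply, ← ofAdd_toAdd x, specHeckeMap_specE, hE,
        ← hθ]
      rfl
  have hs : s ∈ AlgHom.equalizer (F.comp (specHeckeMap q hf a)) ρ := by rw [key]; trivial
  exact LinearMap.congr_fun hs v

end CentralCharacter

/-! ### Restriction of simple modules along a surjection. -/

section Restriction

variable {R S : Type*} [Ring R] [Ring S] {φ : R →+* S}

lemma restrictsSimples_of_surjective (hφ : Function.Surjective φ) : RestrictsSimples.{v} φ := by
  intro M hM
  have : RingHomSurjective φ := ⟨hφ⟩
  let e : ((ModuleCat.restrictScalars φ).obj M) →ₛₗ[φ] M :=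
    { toFun := fun m => m, map_add' := fun _ _ => rfl, map_smul' := fun _ _ => rfl }
  exact (LinearMap.isSimpleModule_iff_of_bijective e Function.bijective_id).2 hM

lemma restrict_injective_of_surjective (hφ : Function.Surjective φ) (h : RestrictsSimples.{v} φ) :
    Function.Injective (Irr.restrict φ h) := by
  rintro ⟨M, hM⟩ ⟨N, hN⟩ hMN
  obtain ⟨e⟩ : Nonempty (((ModuleCat.restrictScalars φ).obj M) ≃ₗ[R]
    ((ModuleCat.restrictScalars φ).obj N)) := Quotient.exact hMN
  refine Quotient.sound ⟨?_⟩
  let e' : M ≃+ N := e.toAddEquiv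
  refine { e' with map_smul' := fun s m => ?_ }
  obtain ⟨r, rfl⟩ := hφ s
  exact e.map_smul r m

end Restriction

end AffHecke

end

theorem mainTheorem11
    {ι X Y ι' X' Y' I : Type*} [Finite ι] [Finite ι'] [Finite I]
    [AddCommGroup X] [AddCommGroup Y] [AddCommGroup X'] [AddCommGroup Y']
    [Module.Finite ℤ X] [Module.Finite ℤ Y] [Module.Finite ℤ X'] [Module.Finite ℤ Y']
    (P : RootDatum ι X Y) (P' : RootDatum ι' X' Y') (b : P.Base) (b' : P'.Base)
    (f : RootPairing.Hom P' P) (hf : AffHecke.IsCentralIsogeny b' b f)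
    (q : AffHecke.ParameterFunction P I)
    (a : AffHecke.TorusPoint X I) (ha : a.IsPositiveReal) :
    ∃ h : AffHecke.RestrictsSimples.{v}
        (AffHecke.specHeckeMap q hf a :
          AffHecke.SpecHecke b' (q.pullback hf) (a.map f) →+* AffHecke.SpecHecke b q a),
      Function.Bijective (AffHecke.Irr.restrict _ h) := by
  have hsurj := AffHecke.specHeckeMap_surjective (q := q) (hf := hf) ha
  refine ⟨AffHecke.restrictsSimples_of_surjective hsurj,
    AffHecke.restrict_injective_of_surjective hsurj _, ?_⟩
  rintro ⟨M, hM⟩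
  let : Module ℂ M := Module.compHom M
    (algebraMap ℂ (AffHecke.SpecHecke b' (q.pullback hf) (a.map f)))
  have : IsScalarTower ℂ (AffHecke.SpecHecke b' (q.pullback hf) (a.map f)) M :=
    ⟨fun c s m => by rw [Algebra.smul_def, mul_smul]; rfl⟩
  obtain ⟨F, hF⟩ := AffHecke.exists_extension (b := b) (q := q) (hf := hf) ha (V := M)
  -- The preimage of the class of `M` is the same additive group with the extended action; `hF` says
  -- that restricting it returns the original one.
  let : Module (AffHecke.SpecHecke b q a) M := Module.compHom M (F : _ →+* Module.End ℂ M)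
  let N : ModuleCat.{v} (AffHecke.SpecHecke b q a) := ModuleCat.of _ M
  let e : ((ModuleCat.restrictScalars (AffHecke.specHeckeMap q hf a :
      AffHecke.SpecHecke b' (q.pullback hf) (a.map f) →+* AffHecke.SpecHecke b q a)).obj N) ≃ₗ[
        AffHecke.SpecHecke b' (q.pullback hf) (a.map f)] M :=
    { AddEquiv.refl M with map_smul' := fun s m => hF s m }
  have : RingHomSurjective (AffHecke.specHeckeMap q hf a :
      AffHecke.SpecHecke b' (q.pullback hf) (a.map f) →+* AffHecke.SpecHecke b q a) := ⟨hsurj⟩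
  have hN : IsSimpleModule (AffHecke.SpecHecke b q a) N := by
    let e' : M →ₛₗ[(AffHecke.specHeckeMap q hf a :
      AffHecke.SpecHecke b' (q.pullback hf) (a.map f) →+* AffHecke.SpecHecke b q a)] N :=
      { toFun := fun m => m, map_add' := fun _ _ => rfl, map_smul' := fun s m => (hF s m).symm }
    exact (LinearMap.isSimpleModule_iff_of_bijective e' Function.bijective_id).1 hM
  exact ⟨Quotient.mk _ ⟨N, hN⟩, Quotient.sound ⟨e⟩⟩
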